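/- Let $\mathcal L$ be a Lie conformal algebra over $\mathbb C$: a $\mathbb C[\partial]$-module with a $\mathbb C$-bilinear $\lambda$-bracket $[\cdot_\lambda\cdot]:\mathcal L\times\mathcal L\to\mathcal L[\lambda]$ such that $[\partial p_\lambda q]=-\lambda[p_\lambda q]$, $[p_\lambda\partial q]=(\partial+\lambda)[p_\lambda q]$, $[p_\lambda q]=-[q_{-\partial-\lambda}p]$ and $[p_\lambda[q_\mu r]]=[[p_\lambda q]_{\lambda+\mu}r]+[q_\mu[p_\lambda r]]$. For $n\ge 1$ let $C^n(\mathcal L,\mathcal L)$ be the space of $\mathbb C$-multilinear maps $f_{\lambda_1,\dots,\lambda_{n-1}}:\mathcal L^{n}\to\mathcal L[\lambda_1,\dots,\lambda_{n-1}]$ that are conformally sesquilinear ($f(\dots,\partial p_i,\dots)=-\lambda_i f(\dots)$ for $i<n$, and $f(\dots,\partial p_n)=(\partial+\lambda_1+\dots+\lambda_{n-1})f(\dots)$) and conformally skew-symmetric ($f_{\lambda_{\sigma(1)},\dots,\lambda_{\sigma(n-1)}}(p_{\sigma(1)},\dots,p_{\sigma(n)})=\operatorname{sgn}(\sigma)\,f_{\lambda_1,\dots,\lambda_{n-1}}(p_1,\dots,p_n)$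 for $\sigma\in S_n$). Here and below, for a map with $n$ arguments, $\lambda_n$ stands for $\lambda_n^\dagger=-\partial-\lambda_1-\dots-\lambda_{n-1}$, where $\partial$ acts on the whole expression. Put $C^*(\mathcal L,\mathcal L)=\bigoplus_{n\ge1}C^n(\mathcal L,\mathcal L)$. The space $C^1(\mathcal L,\mathcal L)$ consists of the $\mathbb C[\partial]$-linear maps $\mathcal L\to\mathcal L$. Write $\mathrm{Sh}(a,b)$ for the set of $\tau\in S_{a+b}$ with $\tau(1)<\dots<\tau(a)$ and $\tau(a+1)<\dots<\tau(a+b)$. For $J\in C^m(\mathcal L,\mathcal L)$ and $K\in C^n(\mathcal L,\mathcal L)$ put $$(J\cup K)_{\lambda_1,\dots,\lambda_{m+n-1}}(p_1,\dots,p_{m+n})=\sum_{\tau\in \mathrm{Sh}(m,n)}\operatorname{sgn}(\tau)\,\big[J_{\lambda_{\tau(1)},\dots,\lambda_{\tau(m-1)}}(p_{\tau(1)},\dots,p_{\tau(m)})_{\lambda_{\tau(1)}+\dots+\lambda_{\tau(m)}}K_{\lambda_{\tau(m+1)},\dots,\lambda_{\tau(m+n-1)}}(p_{\tau(m+1)},\dots,p_{\tau(m+n)})\big],$$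 $$(\iota_KJ)_{\lambda_1,\dots,\lambda_{m+n-2}}(p_1,\dots,p_{m+n-1})=\sum_{\tau\in \mathrm{Sh}(n,m-1)}\operatorname{sgn}(\tau)\,J_{\lambda_{\tau(1)}+\dots+\lambda_{\tau(n)},\lambda_{\tau(n+1)},\dots,\lambda_{\tau(m+n-2)}}\big(K_{\lambda_{\tau(1)},\dots,\lambda_{\tau(n-1)}}(p_{\tau(1)},\dots,p_{\tau(n)}),p_{\tau(n+1)},\dots,p_{\tau(m+n-1)}\big)$$ (when $m=1$, $J$ carries no parameters). For $f\in C^n(\mathcal L,\mathcal L)$ put $$(\delta f)_{\lambda_1,\dots,\lambda_n}(p_1,\dots,p_{n+1})=\sum_{i=1}^{n+1}(-1)^{i+1}[p_i{}_{\lambda_i}f_{\lambda_1,\dots,\widehat{\lambda_i},\dots}(p_1,\dots,\widehat{p_i},\dots,p_{n+1})]+\sum_{i<j}(-1)^{i+j}f_{\lambda_i+\lambda_j,\lambda_1,\dots,\widehat{\lambda_i},\dots,\widehat{\lambda_j},\dots}([p_i{}_{\lambda_i}p_j],p_1,\dots,\widehat{p_i},\dots,\widehat{p_j},\dots,p_{n+1}),$$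 where the parameters of $f$ are the first $n-1$ of those listed (the list ending with $\lambda_{n+1}$ if that is not omitted). The Frölicher–Nijenhuis bracket of $J\in C^m(\mathcal L,\mathcal L)$ and $K\in C^n(\mathcal L,\mathcal L)$ is $$[J,K]_{FN}=J\cup K+(-1)^m\,\iota_{\delta J}K-(-1)^{(m+1)n}\,\iota_{\delta K}J .$$ **Theorem.** The bracket $[-,-]_{FN}$ makes $C^*(\mathcal L,\mathcal L)$ a graded Lie algebra: it extends to a $\mathbb C$-bilinear map on $C^*(\mathcal L,\mathcal L)$, and for $J\in C^m$, $K\in C^n$, $P\in C^r$ one has $[J,K]_{FN}\in C^{m+n}$, $[J,K]_{FN}=-(-1)^{mn}[K,J]_{FN}$ and $[J,[K,P]_{FN}]_{FN}=[[J,K]_{FN},P]_{FN}+(-1)^{mn}[K,[J,P]_{FN}]_{FN}$. Moreover, a $\mathbb C[\partial]$-linear map $N:\mathcal L\to\mathcal L$, i.e. an element $N\in C^1(\mathcal L,\mathcal L)$, is a Nijenhuis operator, i.e. $$[N(p)_\lambda N(q)]=N\big([N(p)_\lambda q]+[p_\lambda N(q)]-N([p_\lambda q])\big)\qquad\text{for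 all }p,q\in\mathcal L,$$ if and only if it is a Maurer–Cartan element of this graded Lie algebra, i.e. $[N,N]_{FN}=0$. -/

import Mathlib

noncomputable section

namespace LieConf

/-! ### Polynomials `L[λ₁,…,λ_k]` with coefficients in a `ℂ[∂]`-module `L`

Throughout `L` is a module over `ℂ[∂]`, i.e. over `Polynomial ℂ`, the variable `X` being `∂`.
Indices start at `0`, so `λ_{i+1}` is the variable with index `i`. -/

section Basic

variable (L : Type*) [AddCommGroup L] [Module ℂ L] [Module (Polynomial ℂ) L]
  [IsScalarTower ℂ (Polynomial ℂ) L]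

/-- The action of `∂` on `L`. -/
def partialOp : Module.End ℂ L := Algebra.lsmul ℂ ℂ L (Polynomial.X : Polynomial ℂ)

/-- `L[λ₁,…,λ_k]`: finitely supported families of coefficients in `L`, indexed by exponents. -/
abbrev LPoly (k : ℕ) : Type _ := (Fin k →₀ ℕ) →₀ L

variable {L}

/-- The constant polynomial with value `a`. -/
def const (k : ℕ) (a : L) : LPoly L k := Finsupp.single 0 a

/-- Multiplication by the variable of index `i` on `L[λ₁,…,λ_k]`. -/
def lam {k : ℕ} (i : Fin k) : Module.End ℂ (LPoly L k) :=
  Finsupp.lmapDomain L ℂ (fun α => α + Finsupp.single i 1)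

/-- A `ℂ`-linear map of `L` acting on the coefficients of polynomials. -/
def onCoeff {k : ℕ} (T : Module.End ℂ L) : Module.End ℂ (LPoly L k) :=
  Finsupp.mapRange.linearMap T

/-- The operator `λ_{k+1}† = -∂ - λ₁ - ⋯ - λ_k` on `L[λ₁,…,λ_k]`. -/
def lamDagger (k : ℕ) : Module.End ℂ (LPoly L k) :=
  -onCoeff (partialOp L) - ∑ i : Fin k, lam i

/-- The `k + 1` spectral operators `λ₁, …, λ_k, λ_{k+1}†` on `L[λ₁,…,λ_k]`. -/
def specOp {k : ℕ} (i : Fin (k + 1)) : Module.End ℂ (LPoly L k) :=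
  Fin.lastCases (motive := fun _ => Module.End ℂ (LPoly L k)) (lamDagger k) (fun j => lam j) i

/-- Substitution: `∑ λ^α a_α ↦ ∑ T₁^{α₁} ⋯ T_k^{α_k} (g a_α)`, for operators `T_i` on `M`
(in all uses pairwise commuting) and a map `g : L → M`. -/
def subst {k : ℕ} {M : Type*} [AddCommGroup M] [Module ℂ M]
    (T : Fin k → Module.End ℂ M) (g : L → M) (P : LPoly L k) : M :=
  P.sum fun α a => (List.ofFn fun i => T i ^ α i).prod (g a)

end Basic

/-! ### Lie conformal algebras and Nijenhuis operators -/

/-- A Lie conformal algebra structure on a `ℂ[∂]`-module `L`: a `ℂ`-bilinear `λ`-bracket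
`L × L → L[λ]` which is sesquilinear, skew-symmetric and satisfies the Jacobi identity. -/
structure LieConformalAlgebra (L : Type*) [AddCommGroup L] [Module ℂ L]
    [Module (Polynomial ℂ) L] [IsScalarTower ℂ (Polynomial ℂ) L] where
  /-- The `λ`-bracket `[p_λ q]`. -/
  bracket : L →ₗ[ℂ] L →ₗ[ℂ] LPoly L 1
  /-- `[(∂p)_λ q] = -λ [p_λ q]`. -/
  sesq_left : ∀ p q, bracket (partialOp L p) q = -lam 0 (bracket p q)
  /-- `[p_λ (∂q)] = (∂ + λ) [p_λ q]`. -/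
  sesq_right : ∀ p q, bracket p (partialOp L q)
    = onCoeff (partialOp L) (bracket p q) + lam 0 (bracket p q)
  /-- `[p_λ q] = -[q_{-∂-λ} p]`. -/
  skew : ∀ p q, bracket p q = -subst (fun _ => lamDagger 1) (const 1) (bracket q p)
  /-- `[p_λ [q_μ r]] = [[p_λ q]_{λ+μ} r] + [q_μ [p_λ r]]` in `L[λ, μ]`. -/
  jacobi : ∀ p q r,
    subst (fun _ => (lam 1 : Module.End ℂ (LPoly L 2)))
        (fun c => subst (fun _ => lam 0) (const 2) (bracket p c)) (bracket q r)
      = subst (fun _ => (lam 0 : Module.End ℂ (LPoly L 2)))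
          (fun c => subst (fun _ => lam 0 + lam 1) (const 2) (bracket c r)) (bracket p q)
        + subst (fun _ => (lam 0 : Module.End ℂ (LPoly L 2)))
          (fun c => subst (fun _ => lam 1) (const 2) (bracket q c)) (bracket p r)

variable {L : Type*} [AddCommGroup L] [Module ℂ L] [Module (Polynomial ℂ) L]
  [IsScalarTower ℂ (Polynomial ℂ) L]

/-- A `ℂ[∂]`-linear map `N` is a Nijenhuis operator if
`[N(p)_λ N(q)] = N([N(p)_λ q] + [p_λ N(q)] - N([p_λ q]))` for all `p`, `q`. -/
def LieConformalAlgebra.IsNijenhuis (A : LieConformalAlgebra L)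
    (N : L →ₗ[Polynomial ℂ] L) : Prop :=
  ∀ p q : L, A.bracket (N p) (N q)
    = onCoeff (N.restrictScalars ℂ) (A.bracket (N p) q + A.bracket p (N q)
        - onCoeff (N.restrictScalars ℂ) (A.bracket p q))

/-- `[p_T q]` in `L[λ₁,…,λ_k]`, for an operator `T` on `L[λ₁,…,λ_k]`. -/
def LieConformalAlgebra.bracketAt (A : LieConformalAlgebra L) {k : ℕ}
    (T : Module.End ℂ (LPoly L k)) (p q : L) : LPoly L k :=
  subst (fun _ => T) (const k) (A.bracket p q)

/-! ### Cochains

The degree of a cochain is the number of its arguments; a cochain of degree `k + 1` takes values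
in `L[λ₁,…,λ_k]`. -/

variable (L) in
/-- Arbitrary maps `f_{λ₁,…,λ_k} : L^{k+1} → L[λ₁,…,λ_k]`. -/
abbrev PreCochain (k : ℕ) : Type _ := (Fin (k + 1) → L) → LPoly L k

/-- `f_{T₁,…,T_k}(p₁,…,p_{k+1})` in `L[λ₁,…,λ_N]`, for operators `T_i` on `L[λ₁,…,λ_N]`. The
family `T` has `k + 1` members, the last of which plays no role. -/
def PreCochain.at {k N : ℕ} (f : PreCochain L k) (T : Fin (k + 1) → Module.End ℂ (LPoly L N))
    (p : Fin (k + 1) → L) : LPoly L N :=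
  subst (fun i => T i.castSucc) (const N) (f p)

variable (L) in
/-- The space `C^{k+1}(L, L)` of `ℂ`-multilinear maps `f_{λ₁,…,λ_k} : L^{k+1} → L[λ₁,…,λ_k]` that
are conformally sesquilinear, `f(…,∂p_i,…) = -λ_i f(…)` for `i ≤ k` and
`f(…,∂p_{k+1}) = (∂ + λ₁ + ⋯ + λ_k) f(…)`, and conformally skew-symmetric,
`f_{λ_{σ(1)},…,λ_{σ(k)}}(p_{σ(1)},…,p_{σ(k+1)}) = sgn(σ) f_{λ₁,…,λ_k}(p₁,…,p_{k+1})`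
with `λ_{k+1}` replaced by `λ_{k+1}†`. -/
def cochains (k : ℕ) : Submodule ℂ (MultilinearMap ℂ (fun _ : Fin (k + 1) => L) (LPoly L k)) where
  carrier := {f |
    (∀ (p : Fin (k + 1) → L) (i : Fin (k + 1)),
      f (Function.update p i (partialOp L (p i))) = -specOp i (f p)) ∧
    (∀ (σ : Equiv.Perm (Fin (k + 1))) (p : Fin (k + 1) → L),
      PreCochain.at (f : PreCochain L k) (fun i => specOp (σ i)) (fun i => p (σ i))
        = (Equiv.Perm.sign σ : ℤ) • f p)}
  add_mem' := by
    rintro f g ⟨hf, hf'⟩ ⟨hg, hg'⟩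
    refine ⟨fun p i => ?_, fun σ p => ?_⟩
    · simp only [add_apply, hf, hg, map_add, neg_add]
    · have h1 := hf' σ p
      have h2 := hg' σ p
      simp only [PreCochain.at, subst, const, add_apply] at h1 h2 ⊢
      rw [Finsupp.sum_add_index', h1, h2, smul_add]
      · intro a; simp
      · intro a b c; simp
  zero_mem' := by
    refine ⟨fun p i => ?_, fun σ p => ?_⟩
    · simp
    · simp [PreCochain.at, subst]
  smul_mem' := by
    rintro c f ⟨hf, hf'⟩
    refine ⟨fun p i => ?_, fun σ p => ?_⟩
    · simp only [smul_apply, hf, map_smul, smul_neg]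
    · have h1 := hf' σ p
      simp only [PreCochain.at, subst, const, smul_apply] at h1 ⊢
      rw [smul_comm, ← h1, Finsupp.sum_smul_index', Finsupp.smul_sum]
      · refine Finsupp.sum_congr fun a _ => ?_
        rw [← LinearMap.map_smul, Finsupp.smul_single]
      · intro a; simp

variable (L) in
/-- The graded space `C^*(L, L) = ⨁_{n ≥ 1} C^n(L, L)`; the summand with index `k` is `C^{k+1}`. -/
abbrev CStar : Type _ := DirectSum ℕ fun k => cochains L k

/-- The inclusion of `C^{k+1}(L, L)` in `C^*(L, L)`. -/
abbrev ofDeg (k : ℕ) : cochains L k →ₗ[ℂ] CStar L :=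
  DirectSum.lof ℂ ℕ (fun k => cochains L k) k

variable (L) in
/-- The homogeneous part of degree `n` of `C^*(L, L)`, which vanishes for `n = 0`. -/
def degreePart : ℕ → Submodule ℂ (CStar L)
  | 0 => ⊥
  | k + 1 => LinearMap.range (ofDeg k)

/-- A `ℂ[∂]`-linear map `N : L → L`, regarded as an element of `C¹(L, L)`. -/
def oneCochain (N : L →ₗ[Polynomial ℂ] L) : cochains L 0 :=
  ⟨{  toFun := fun p => const 0 (N (p 0))
      map_update_add' := by
        intro _ p i x y
        obtain rfl : i = 0 := Fin.fin_one_eq_zero i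
        simp [const]
      map_update_smul' := by
        intro _ p i c x
        obtain rfl : i = 0 := Fin.fin_one_eq_zero i
        simp only [Function.update_self, const, Finsupp.smul_single]
        rw [← LinearMap.map_smul_of_tower] },
    by
      refine ⟨fun p i => ?_, fun σ p => ?_⟩
      · obtain rfl : i = Fin.last 0 := Fin.fin_one_eq_zero i
        simp only [specOp, Fin.lastCases_last]
        simp [lamDagger, onCoeff, partialOp, const]
      · obtain rfl : σ = 1 := Equiv.ext fun i => (Fin.fin_one_eq_zero _).trans (Fin.fin_one_eq_zero i).symm
        simp [PreCochain.at, subst, const]⟩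

/-! ### Shuffles and the operations on cochains -/

/-- The permutations `τ` of `{1,…,M}` with `τ(1) < ⋯ < τ(a)` and `τ(a+1) < ⋯ < τ(M)`. -/
def shuffles (a M : ℕ) : Finset (Equiv.Perm (Fin M)) :=
  Finset.univ.filter fun τ => ∀ i j : Fin M, i < j → (j.val < a ∨ a ≤ i.val) → τ i < τ j

/-- The first `a` indices among `M = a + b`. -/
def fstBlock {a b M : ℕ} (h : a + b = M) (i : Fin a) : Fin M := Fin.cast h (Fin.castAdd b i)

/-- The last `b` indices among `M = a + b`. -/
def sndBlock {a b M : ℕ} (h : a + b = M) (j : Fin b) : Fin M := Fin.cast h (Fin.natAdd a j)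

/-- The insertion `J ⊚ K` of `K ∈ C^n` into `J ∈ C^m`, with `m = k + 1` and `n = l + 1`:
`(J ⊚ K)(p₁,…,p_{m+n-1})` is the sum over the `(n, m-1)`-shuffles `τ` of
`sgn(τ) J_{λ_{τ(1)}+⋯+λ_{τ(n)}, λ_{τ(n+1)}, …}(K_{λ_{τ(1)},…,λ_{τ(n-1)}}(p_{τ(1)},…,p_{τ(n)}),
p_{τ(n+1)}, …, p_{τ(m+n-1)})`, with `λ_{m+n-1}` replaced by `λ_{m+n-1}†`. -/
def insertion {k l N : ℕ} (h : k + l = N) (J : PreCochain L k) (K : PreCochain L l) :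
    PreCochain L N := fun p =>
  have h' : (l + 1) + k = N + 1 := by omega
  ∑ τ ∈ shuffles (l + 1) (N + 1), (Equiv.Perm.sign τ : ℤ) •
    subst (fun i : Fin l => specOp (τ (fstBlock h' i.castSucc)))
      (fun c : L => J.at
        (Fin.cons (∑ i, specOp (τ (fstBlock h' i))) fun j => specOp (τ (sndBlock h' j)))
        (Fin.cons c fun j => p (τ (sndBlock h' j))))
      (K fun i => p (τ (fstBlock h' i)))

/-- The cup product of `J ∈ C^m` and `K ∈ C^n`, with `m = k + 1` and `n = l + 1`:
`(J ∪ K)(p₁,…,p_{m+n})` is the sum over the `(m, n)`-shuffles `τ` of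
`sgn(τ) [J_{λ_{τ(1)},…,λ_{τ(m-1)}}(p_{τ(1)},…,p_{τ(m)})_{λ_{τ(1)}+⋯+λ_{τ(m)}}
K_{λ_{τ(m+1)},…,λ_{τ(m+n-1)}}(p_{τ(m+1)},…,p_{τ(m+n)})]`,
with `λ_{m+n}` replaced by `λ_{m+n}†`. -/
def LieConformalAlgebra.cup (A : LieConformalAlgebra L) {k l : ℕ} (J : PreCochain L k)
    (K : PreCochain L l) : PreCochain L (k + l + 1) := fun p =>
  have h' : (k + 1) + (l + 1) = k + l + 1 + 1 := by omega
  ∑ τ ∈ shuffles (k + 1) (k + l + 1 + 1), (Equiv.Perm.sign τ : ℤ) •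
    subst (fun i : Fin k => specOp (τ (fstBlock h' i.castSucc)))
      (fun a : L =>
        subst (fun j : Fin l => specOp (τ (sndBlock h' j.castSucc)))
          (fun b : L => A.bracketAt (∑ i, specOp (τ (fstBlock h' i))) a b)
          (K fun j => p (τ (sndBlock h' j))))
      (J fun i => p (τ (fstBlock h' i)))

/-- The coboundary operator with coefficients in the adjoint representation. The second sum runs
over the pairs `i < j`, and `x ↦ j.succAbove (i.succAbove x)` enumerates the indices other than
`i` and `j` in increasing order. -/
def LieConformalAlgebra.coboundary (A : LieConformalAlgebra L) {k : ℕ} (f : PreCochain L k) :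
    PreCochain L (k + 1) := fun p =>
  (∑ i : Fin (k + 2), (-1 : ℤ) ^ (i : ℕ) •
    subst (fun x : Fin k => specOp (i.succAbove x.castSucc))
      (fun c : L => A.bracketAt (specOp i) (p i) c)
      (f fun x => p (i.succAbove x)))
  + ∑ j : Fin (k + 2), ∑ i : Fin (k + 1), if i.castSucc < j then
      (-1 : ℤ) ^ ((i : ℕ) + (j : ℕ)) •
        subst (fun _ : Fin 1 => specOp i.castSucc)
          (fun c : L => f.at
            (Fin.cons (specOp i.castSucc + specOp j) fun x =>
              specOp (j.succAbove (i.succAbove x)))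
            (Fin.cons c fun x => p (j.succAbove (i.succAbove x))))
          (A.bracket (p i.castSucc) (p j))
    else 0

/-- The Frölicher–Nijenhuis bracket of `J ∈ C^m` and `K ∈ C^n`, with `m = k + 1` and `n = l + 1`:
`[J, K] = J ∪ K + (-1)^m i_{δJ} K - (-1)^{(m+1)n} i_{δK} J`, where `i_P Q` is the insertion of
`P` into `Q`. -/
def LieConformalAlgebra.fnBracket (A : LieConformalAlgebra L) {k l : ℕ} (J : PreCochain L k)
    (K : PreCochain L l) : PreCochain L (k + l + 1) :=
  A.cup J K
    + (-1 : ℤ) ^ (k + 1) • insertion (by omega) K (A.coboundary J)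
    - (-1 : ℤ) ^ ((k + 1 + 1) * (l + 1)) • insertion (by omega) J (A.coboundary K)

/-! ### Graded Lie algebras -/

/-- A `ℂ`-bilinear bracket `br` makes the space `W`, graded by the subspaces `G n`, into a graded
Lie algebra. -/
structure IsGradedLieAlgebra {W : Type*} [AddCommMonoid W] [Module ℂ W] (G : ℕ → Submodule ℂ W)
    (br : W →ₗ[ℂ] W →ₗ[ℂ] W) : Prop where
  grading : DirectSum.IsInternal G
  bracket_mem : ∀ {m n : ℕ} {x y : W}, x ∈ G m → y ∈ G n → br x y ∈ G (m + n)
  skew : ∀ {m n : ℕ} {x y : W}, x ∈ G m → y ∈ G n → br x y = (-(-1 : ℂ) ^ (m * n)) • br y x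
  jacobi : ∀ {m n r : ℕ} {x y z : W}, x ∈ G m → y ∈ G n → z ∈ G r →
    br x (br y z) = br (br x y) z + (-1 : ℂ) ^ (m * n) • br y (br x z)

/-- A Maurer–Cartan element: an element `x` of degree `1` with `[x, x] = 0`. -/
def IsMaurerCartan {W : Type*} [AddCommMonoid W] [Module ℂ W] (G : ℕ → Submodule ℂ W)
    (br : W →ₗ[ℂ] W →ₗ[ℂ] W) (x : W) : Prop :=
  x ∈ G 1 ∧ br x x = 0

end LieConf

end

/-!
# The Frölicher–Nijenhuis bracket of a Lie conformal algebra

The insertion `J ⊚ K` makes the conformal cochains a graded right pre-Lie algebra, `J ∈ C^{k+1}`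
having degree `k`, and the `λ`-bracket is an element `π` of degree one with `π ⊚ π = 0`. Everything
else is expressed by these data: up to sign, the cup product is the associator
`(π ⊚ J) ⊚ K - π ⊚ (J ⊚ K)`, and the coboundary is the graded commutator with `π`. Besides the
pre-Lie identity only one further fact is used: since `π` has two arguments, the associator, which
consists of the simultaneous insertions of `J` and `K` in `π`, turns the right insertion of a third
cochain into a graded derivation. From these axioms (`IsPreLieWithSquareZero`) the cup product
satisfies a Jacobi identity, the coboundary takes the Frölicher–Nijenhuis bracket to the graded
commutator (`diff_fn`), and the Jacobi identity of the Frölicher–Nijenhuis bracket follows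
(`fn_jacobi`).

The axioms have to be verified for cochains, with sums over shuffles, the substitution of
`λ₁, …, λ_k` by commuting operators and the exceptional last parameter
`λ_{k+1}† = -∂ - λ₁ - ⋯ - λ_k`. To this end all parameters are put on the same footing. A weighted
point is an element of `L` with a value of its spectral parameter in a commutative ring `R`. A
cochain is evaluated on a list of weighted points, and its value is seen only through maps
`φ : L → M` to `R`-modules on which `∂` acts by minus the total weight of the list; this is the
relation between `∂` and the parameters which defines `λ_{k+1}†`. Sesquilinearity then says that a
cochain has the same property in each of its arguments, skew-symmetry becomes a sign under exchange
of neighbours in the list (`IsConformal`), and no parameter is exceptional. The operators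
`λ₁, …, λ_k, λ_{k+1}†` commute, hence generate a commutative ring (`exists_commRing_specOp`), and
evaluation over this ring recovers the cochain (`PreCochain.ext_functional`, `exists_cochain`).

Sums over shuffles become signed sums over the ways to split a list into two complementary sublists
(`unsh`, `sum_shuffles`). The identities required are those of a graded cocommutative coassociative
coproduct (`unsh_unsh_left`, `unsh_comm`). They give `comp_comp` and `brace_symm`, hence the pre-Lie
identity, and `brace_comp`, hence the derivation property.

For a `ℂ[∂]`-linear map `N` the bracket `[N, N]` is twice the Nijenhuis torsion of `N`, so the
Nijenhuis operators are the Maurer–Cartan elements.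
-/

noncomputable section

namespace LieConf

universe u

/-! ### Graded right pre-Lie algebras with a square-zero element of degree one -/

section PreLie

set_option linter.unusedSimpArgs false

variable {V : Type*} [AddCommGroup V] [Module ℂ V]

/-- A product `m` on a space with subspaces `G i`, the degree in `G i` being `i`, which is a graded
right pre-Lie product, with an element `π` of degree one such that `m π π = 0` and such that the
associator of `π`, `x`, `y`, multiplied by `z`, is obtained by multiplying `x` and `y` by `z` in
turn. The model is the insertion product of multilinear operations, with `π` a bracket: as `π` has
two arguments, its associator consists of the simultaneous insertions of `x` and `y`, and a third
operation can only be inserted in one of them. -/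
structure IsPreLieWithSquareZero (G : ℕ → Submodule ℂ V) (m : V →ₗ[ℂ] V →ₗ[ℂ] V) (π : V) :
    Prop where
  mul_mem : ∀ {i j : ℕ} {x y : V}, x ∈ G i → y ∈ G j → m x y ∈ G (i + j)
  right_symm : ∀ {i j k : ℕ} {x y z : V}, x ∈ G i → y ∈ G j → z ∈ G k →
    m (m x y) z - m x (m y z) = (-1 : ℂ) ^ (j * k) • (m (m x z) y - m x (m z y))
  mem_one : π ∈ G 1
  sq_zero : m π π = 0
  quadratic : ∀ {i j k : ℕ} {x y z : V}, x ∈ G i → y ∈ G j → z ∈ G k →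
    m (m (m π x) y - m π (m x y)) z = (m (m π x) (m y z) - m π (m x (m y z)))
      + (-1 : ℂ) ^ (k * j) • (m (m π (m x z)) y - m π (m (m x z) y))

namespace IsPreLieWithSquareZero

variable {G : ℕ → Submodule ℂ V} {m : V →ₗ[ℂ] V →ₗ[ℂ] V} {π : V}

/-- The associator of `π`, `x`, `y`; up to sign this is the cup product. -/
def cupProd (m : V →ₗ[ℂ] V →ₗ[ℂ] V) (π : V) : V →ₗ[ℂ] V →ₗ[ℂ] V :=
  LinearMap.mk₂ ℂ (fun x y => m (m π x) y - m π (m x y))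
    (fun _ _ _ => by simp only [map_add, LinearMap.add_apply]; abel)
    (fun _ _ _ => by simp only [map_smul, LinearMap.smul_apply, smul_sub])
    (fun _ _ _ => by simp only [map_add]; abel)
    (fun _ _ _ => by simp only [map_smul, smul_sub])

/-- The coboundary of an element of degree `i`, which is a graded commutator with `π`. -/
def diff (m : V →ₗ[ℂ] V →ₗ[ℂ] V) (π : V) (i : ℕ) (x : V) : V := (-1 : ℂ) ^ i • m π x - m x π

/-- The Frölicher–Nijenhuis bracket of elements of degrees `i` and `j`. These degrees are those of
the pre-Lie product, one less than the degrees for which the bracket is graded. -/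
def fn (m : V →ₗ[ℂ] V →ₗ[ℂ] V) (π : V) (i j : ℕ) (x y : V) : V :=
  (-1 : ℂ) ^ ((i + 1) * j) • cupProd m π x y + (-1 : ℂ) ^ (i + 1) • m y (diff m π i x)
    - (-1 : ℂ) ^ ((i + 1 + 1) * (j + 1)) • m x (diff m π j y)

lemma sign_cases (i : ℕ) : (-1 : ℂ) ^ i = 1 ∨ (-1 : ℂ) ^ i = -1 := neg_one_pow_eq_or ℂ i

lemma mul_mul (x y : V) : m (m π x) y = cupProd m π x y + m π (m x y) := by
  simp [cupProd]

variable (h : IsPreLieWithSquareZero G m π)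
include h

lemma diff_mem {i : ℕ} {x : V} (hx : x ∈ G i) : diff m π i x ∈ G (i + 1) :=
  (G (i + 1)).sub_mem ((G (i + 1)).smul_mem _ (add_comm 1 i ▸ h.mul_mem h.mem_one hx))
    (h.mul_mem hx h.mem_one)

lemma cupProd_mem {i j : ℕ} {x y : V} (hx : x ∈ G i) (hy : y ∈ G j) :
    cupProd m π x y ∈ G (i + j + 1) := by
  refine (G _).sub_mem ?_ ?_
  · convert h.mul_mem (h.mul_mem h.mem_one hx) hy using 2; ring
  · convert h.mul_mem h.mem_one (h.mul_mem hx hy) using 2; ring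

lemma fn_mem {i j : ℕ} {x y : V} (hx : x ∈ G i) (hy : y ∈ G j) :
    fn m π i j x y ∈ G (i + j + 1) := by
  refine (G _).sub_mem ((G _).add_mem ((G _).smul_mem _ (h.cupProd_mem hx hy))
    ((G _).smul_mem _ ?_)) ((G _).smul_mem _ ?_)
  · convert h.mul_mem hy (h.diff_mem hx) using 2; ring
  · exact (h.mul_mem hx (h.diff_mem hy) :)

lemma cupProd_symm {i j : ℕ} {x y : V} (hx : x ∈ G i) (hy : y ∈ G j) :
    cupProd m π x y = (-1 : ℂ) ^ (i * j) • cupProd m π y x :=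
  h.right_symm h.mem_one hx hy

/-- Right multiplication by `z` is a graded derivation of the cup product. -/
lemma cupProd_mul {i j k : ℕ} {x y z : V} (hx : x ∈ G i) (hy : y ∈ G j) (hz : z ∈ G k) :
    m (cupProd m π x y) z
      = cupProd m π x (m y z) + (-1 : ℂ) ^ (k * j) • cupProd m π (m x z) y :=
  h.quadratic hx hy hz

lemma cupProd_pi (x : V) : cupProd m π π x = - m π (m π x) := by
  simp [cupProd, h.sq_zero]

/-- Left multiplication by `π` is, up to sign, a derivation of the cup product: this is
`cupProd_mul` for the cup product with `π`, as `cupProd m π π x = - m π (m π x)`. -/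
lemma pi_cupProd {i j : ℕ} {x y : V} (hx : x ∈ G i) (hy : y ∈ G j) :
    m π (cupProd m π x y)
      = - cupProd m π (m π x) y - (-1 : ℂ) ^ i • cupProd m π x (m π y) := by
  have h1 := h.cupProd_mul h.mem_one hx hy
  have h2 := h.cupProd_symm (h.mul_mem h.mem_one hy) hx
  rw [h.cupProd_pi, h.cupProd_pi, map_neg, LinearMap.neg_apply, mul_mul, mul_mul, map_add, h2] at h1
  rcases sign_cases i with hi | hi <;> rcases sign_cases j with hj | hj <;>
  simp only [pow_add, pow_mul, add_mul, mul_add, one_mul, mul_one, hi, hj, one_pow, pow_one,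
      smul_smul, mul_neg, neg_neg, one_smul, neg_smul, neg_mul] at h1 ⊢ <;>
  linear_combination (norm := module) (-1 : ℂ) • h1

/-- The Jacobi identity of the cup product: multiply `mul_mul x y` by `z`, and expand the product
with `π` by the derivation property `pi_cupProd`. -/
lemma cupProd_jacobi {i j k : ℕ} {x y z : V} (hx : x ∈ G i) (hy : y ∈ G j) (hz : z ∈ G k) :
    cupProd m π (cupProd m π x y) z = -(-1 : ℂ) ^ (j * k) • cupProd m π (cupProd m π x z) y
      - (-1 : ℂ) ^ i • cupProd m π x (cupProd m π y z) := by
  have h0 := mul_mul (m := m) (π := π) (cupProd m π x y) z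
  rw [h.cupProd_mul hx hy hz, h.pi_cupProd hx hy] at h0
  simp only [map_add, map_sub, map_neg, map_smul, LinearMap.sub_apply, LinearMap.neg_apply,
    LinearMap.smul_apply] at h0
  rw [h.cupProd_mul (h.mul_mem h.mem_one hx) hy hz, h.cupProd_mul hx (h.mul_mem h.mem_one hy) hz,
    h.pi_cupProd hx (h.mul_mem hy hz), h.pi_cupProd (h.mul_mem hx hz) hy,
    mul_mul x z, mul_mul y z] at h0
  simp only [map_add, LinearMap.add_apply] at h0
  rcases sign_cases i with hi | hi <;> rcases sign_cases j with hj | hj <;>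
  rcases sign_cases k with hk | hk <;>
  simp only [pow_add, pow_mul, add_mul, mul_add, one_mul, mul_one, hi, hj, hk, one_pow, pow_one,
      smul_smul, mul_neg, neg_neg, one_smul, neg_smul, neg_mul] at h0 ⊢ <;>
  linear_combination (norm := module) (-1 : ℂ) • h0

lemma diff_cupProd {i j : ℕ} {x y : V} (hx : x ∈ G i) (hy : y ∈ G j) :
    diff m π (i + j + 1) (cupProd m π x y)
      = (-1 : ℂ) ^ j • cupProd m π (diff m π i x) y + cupProd m π x (diff m π j y) := by
  rw [diff, h.pi_cupProd hx hy, h.cupProd_mul hx hy h.mem_one, diff, diff]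
  simp only [map_sub, map_smul, LinearMap.sub_apply, LinearMap.smul_apply]
  rcases sign_cases i with hi | hi <;> rcases sign_cases j with hj | hj <;>
  simp only [pow_add, pow_mul, add_mul, mul_add, one_mul, mul_one, hi, hj, one_pow, pow_one,
      smul_smul, mul_neg, neg_neg, one_smul, neg_smul, neg_mul] <;>
  module

lemma mul_pi_mul_pi {i : ℕ} {x : V} (hx : x ∈ G i) : m (m x π) π = 0 := by
  have h1 := h.right_symm hx h.mem_one h.mem_one
  simp only [h.sq_zero, map_zero, sub_zero, mul_one, pow_one, neg_smul, one_smul] at h1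
  have h2 : (2 : ℂ) • m (m x π) π = 0 := by rw [two_smul]; nth_rw 1 [h1]; simp
  exact (smul_eq_zero.mp h2).resolve_left two_ne_zero

lemma diff_diff {i : ℕ} {x : V} (hx : x ∈ G i) : diff m π (i + 1) (diff m π i x) = 0 := by
  have h1 := h.mul_pi_mul_pi hx
  have h2 := h.cupProd_symm hx h.mem_one
  have h3 := mul_mul (m := m) (π := π) x π
  rw [h2, h.cupProd_pi] at h3
  simp only [diff, map_sub, map_smul, LinearMap.sub_apply, LinearMap.smul_apply, h1, h3]
  rcases sign_cases i with hi | hi <;> simp [pow_add, hi] <;> abel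

/-- The coboundary of a product whose right factor is a coboundary. -/
lemma diff_mul_diff {i j : ℕ} {x y : V} (hx : x ∈ G i) (hy : y ∈ G j) :
    diff m π (i + j + 1) (m y (diff m π i x))
      = (-1 : ℂ) ^ (i + 1) • m (diff m π j y) (diff m π i x)
        + (-1 : ℂ) ^ (i + j) • cupProd m π y (diff m π i x) := by
  have hX := h.diff_mem hx
  have h0 := h.diff_diff hx
  generalize diff m π i x = X at *
  rw [diff, sub_eq_zero] at h0
  have h1 := h.right_symm hy hX h.mem_one
  have h2 := mul_mul (m := m) (π := π) y X
  rw [← h0, map_smul] at h1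
  simp only [diff, map_sub, map_smul, LinearMap.sub_apply, LinearMap.smul_apply, h2]
  rw [sub_eq_iff_eq_add] at h1
  rw [h1]
  rcases sign_cases i with hi | hi <;> rcases sign_cases j with hj | hj <;>
  simp only [pow_add, pow_mul, add_mul, mul_add, one_mul, mul_one, hi, hj, one_pow, pow_one,
      smul_smul, mul_neg, neg_neg, one_smul, neg_smul, neg_mul] <;>
  module

/-- The coboundary operator maps the Frölicher–Nijenhuis bracket to the graded commutator. -/
lemma diff_fn {i j : ℕ} {x y : V} (hx : x ∈ G i) (hy : y ∈ G j) :
    diff m π (i + j + 1) (fn m π i j x y)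
      = m (diff m π j y) (diff m π i x)
        - (-1 : ℂ) ^ ((i + 1) * (j + 1)) • m (diff m π i x) (diff m π j y) := by
  have h1 := h.diff_cupProd hx hy
  have h2 := h.diff_mul_diff hx hy
  have h3 := h.diff_mul_diff hy hx
  have h4 := h.cupProd_symm hy (h.diff_mem hx)
  have key : diff m π (i + j + 1) (fn m π i j x y)
    = (-1 : ℂ) ^ ((i + 1) * j) • diff m π (i + j + 1) (cupProd m π x y)
    + (-1 : ℂ) ^ (i + 1) • diff m π (i + j + 1) (m y (diff m π i x))
    - (-1 : ℂ) ^ ((i + 1 + 1) * (j + 1)) • diff m π (i + j + 1) (m x (diff m π j y)) := by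
    simp only [diff, fn, map_add, map_sub, map_smul, LinearMap.add_apply, LinearMap.sub_apply,
      LinearMap.smul_apply]
    module
  rw [key, h1, h2, add_comm i j, h3, h4]
  rcases sign_cases i with hi | hi <;> rcases sign_cases j with hj | hj <;>
  simp only [pow_add, pow_mul, add_mul, mul_add, one_mul, mul_one, hi, hj, one_pow, pow_one,
      smul_smul, mul_neg, neg_neg, one_smul, neg_smul, neg_mul] <;>
  module

lemma fn_symm {i j : ℕ} {x y : V} (hx : x ∈ G i) (hy : y ∈ G j) :
    fn m π i j x y = -(-1 : ℂ) ^ ((i + 1) * (j + 1)) • fn m π j i y x := by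
  rw [fn, fn, h.cupProd_symm hx hy]
  rcases sign_cases i with hi | hi <;> rcases sign_cases j with hj | hj <;>
  simp only [pow_add, pow_mul, add_mul, mul_add, one_mul, mul_one, hi, hj, one_pow, pow_one,
      smul_smul, mul_neg, neg_neg, one_smul, neg_smul, neg_mul] <;>
  module

/-- The Jacobi identity of the Frölicher–Nijenhuis bracket. By `diff_fn` the coboundaries of the
inner brackets are commutators. What remains are the terms with three cup products, which cancel by
`cupProd_jacobi`, those with one coboundary, which cancel by the derivation property `cupProd_mul`,
and those with two coboundaries, which cancel by the pre-Lie identity. -/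
lemma fn_jacobi {i j k : ℕ} {x y z : V} (hx : x ∈ G i) (hy : y ∈ G j) (hz : z ∈ G k) :
    fn m π i (j + k + 1) x (fn m π j k y z) = fn m π (i + j + 1) k (fn m π i j x y) z
      + (-1 : ℂ) ^ ((i + 1) * (j + 1)) • fn m π j (i + k + 1) y (fn m π i k x z) := by
  have hX := h.diff_mem hx
  have hY := h.diff_mem hy
  have hZ := h.diff_mem hz
  rw [fn.eq_def m π i (j + k + 1), fn.eq_def m π (i + j + 1) k, fn.eq_def m π j (i + k + 1),
    h.diff_fn hx hy, h.diff_fn hx hz, h.diff_fn hy hz, fn, fn, fn]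
  -- instances of the rules in which `X`, `Y`, `Z` are the coboundaries of `x`, `y`, `z`
  have c1 := h.cupProd_mul hy hz hX
  have c2 := h.cupProd_mul hx hy hZ
  have c3 := h.cupProd_mul hx hz hY
  have c4 := h.cupProd_symm (h.mul_mem hx hZ) hy
  have c5 := h.cupProd_jacobi hx hy hz
  have c6 := h.cupProd_symm hy (h.cupProd_mem hx hz)
  have r1 := h.right_symm hx hY hZ
  have r2 := h.right_symm hy hX hZ
  have r3 := h.right_symm hz hX hY
  rw [c4] at c2
  generalize diff m π i x = X at *
  generalize diff m π j y = Y at *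
  generalize diff m π k z = Z at *
  simp only [map_add, map_sub, map_smul, LinearMap.add_apply, LinearMap.sub_apply,
      LinearMap.smul_apply, c1, c2, c3, c5, c6]
  rw [sub_eq_iff_eq_add] at r1 r2 r3
  rw [r1, r2, r3]
  rcases sign_cases i with hi | hi <;> rcases sign_cases j with hj | hj <;>
  rcases sign_cases k with hk | hk <;>
  simp only [pow_add, pow_mul, add_mul, mul_add, one_mul, mul_one, hi, hj, hk, one_pow, pow_one,
      smul_smul, mul_neg, neg_neg, one_smul, neg_smul, neg_mul] <;>
  module

end IsPreLieWithSquareZero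
end PreLie

/-! ### Signed sums over unshuffles of a list -/

section Unshuffle

variable {X : Type*} {V W : Type*} [AddCommGroup V] [AddCommGroup W]

/-- The signed sum of `g A B` over all ways to split a list into two complementary sublists `A`
and `B`, the sign being that of the permutation which moves `A` to the front. -/
def unsh : List X → (List X → List X → V) → V
  | [], g => g [] []
  | x :: xs, g => unsh xs (fun A B => g (x :: A) B)
      + unsh xs (fun A B => (-1 : ℤ) ^ A.length • g A (x :: B))

@[simp] lemma unsh_nil (g : List X → List X → V) : unsh [] g = g [] [] := rfl

lemma unsh_cons (x : X) (xs : List X) (g : List X → List X → V) :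
    unsh (x :: xs) g = unsh xs (fun A B => g (x :: A) B)
      + unsh xs (fun A B => (-1 : ℤ) ^ A.length • g A (x :: B)) := rfl

lemma unsh_congr {xs : List X} {g g' : List X → List X → V}
    (h : ∀ A B, (A ++ B).Perm xs → g A B = g' A B) : unsh xs g = unsh xs g' := by
  induction xs generalizing g g' with
  | nil => exact h [] [] (by simp)
  | cons x xs ih =>
    rw [unsh_cons, unsh_cons]
    congr 1
    · exact ih fun A B hp => h _ _ (by simpa using hp)
    · exact ih fun A B hp => by
        rw [h _ _ (List.perm_middle.trans (hp.cons x))]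

lemma map_unsh {F : Type*} [FunLike F V W] [AddMonoidHomClass F V W] (f : F) (xs : List X)
    (g : List X → List X → V) : f (unsh xs g) = unsh xs fun A B => f (g A B) := by
  induction xs generalizing g with
  | nil => rfl
  | cons x xs ih => simp only [unsh_cons, map_add, ih, map_zsmul]

lemma unsh_add (xs : List X) (g g' : List X → List X → V) :
    unsh xs (fun A B => g A B + g' A B) = unsh xs g + unsh xs g' := by
  induction xs generalizing g g' with
  | nil => rfl
  | cons x xs ih => simp only [unsh_cons, smul_add, ih]; abel

lemma unsh_zsmul (n : ℤ) (xs : List X) (g : List X → List X → V) :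
    unsh xs (fun A B => n • g A B) = n • unsh xs g :=
  (map_unsh (zsmulAddGroupHom n : V →+ V) xs g).symm

@[simp] lemma unsh_zero (xs : List X) : unsh xs (fun _ _ => (0 : V)) = 0 := by
  induction xs with
  | nil => rfl
  | cons x xs ih => simp [unsh_cons, ih]

lemma unsh_neg (xs : List X) (g : List X → List X → V) :
    unsh xs (fun A B => - g A B) = - unsh xs g := by
  simpa using unsh_zsmul (-1) xs g

lemma unsh_apply {Y : Type*} (xs : List X) (g : List X → List X → Y → V) (y : Y) :
    unsh xs g y = unsh xs fun A B => g A B y :=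
  map_unsh (Pi.evalAddMonoidHom (fun _ : Y => V) y) xs g

lemma unsh_mem {S : Type*} [SetLike S V] [AddSubgroupClass S V] (s : S) {xs : List X}
    {g : List X → List X → V} (h : ∀ A B, (A ++ B).Perm xs → g A B ∈ s) : unsh xs g ∈ s := by
  induction xs generalizing g with
  | nil => exact h [] [] (by simp)
  | cons x xs ih =>
    exact add_mem (ih fun A B hp => h _ _ (by simpa using hp))
      (ih fun A B hp => zsmul_mem (h _ _ (List.perm_middle.trans (hp.cons x))) _)

lemma unsh_exchange {Y : Type*} (xs : List X) (ys : List Y)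
    (g : List X → List X → List Y → List Y → V) :
    unsh xs (fun A B => unsh ys fun C D => g A B C D)
      = unsh ys fun C D => unsh xs fun A B => g A B C D := by
  induction xs generalizing g with
  | nil => rfl
  | cons x xs ih => simp only [unsh_cons, ← unsh_zsmul, ih, unsh_add]

/-- Coassociativity of unshuffling. -/
lemma unsh_unsh_left (xs : List X) (g : List X → List X → List X → V) :
    unsh xs (fun A C => unsh A fun A B => g A B C)
      = unsh xs (fun A C => unsh C fun B C => g A B C) := by
  induction xs generalizing g with
  | nil => rfl
  | cons x xs ih =>
    have h1 : unsh xs (fun A C => (-1 : ℤ) ^ A.length • unsh A fun A B => g A B (x :: C))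
        = unsh xs (fun A C => unsh A fun A B =>
          ((-1 : ℤ) ^ A.length * (-1 : ℤ) ^ B.length) • g A B (x :: C)) :=
      unsh_congr fun A C _ => by
        rw [← unsh_zsmul]
        refine unsh_congr fun A' B' hp => ?_
        rw [← hp.length_eq, List.length_append, pow_add]
    simp only [unsh_cons, unsh_add, h1, ih, smul_add]
    simp only [← unsh_zsmul, smul_smul]
    abel

/-- Graded cocommutativity of unshuffling. -/
lemma unsh_comm (xs : List X) (g : List X → List X → V) :
    unsh xs g = unsh xs fun A B => (-1 : ℤ) ^ (A.length * B.length) • g B A := by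
  induction xs generalizing g with
  | nil => simp
  | cons x xs ih =>
    rw [unsh_cons, ih, ih fun A B => (-1 : ℤ) ^ A.length • g A (x :: B), unsh_cons, add_comm]
    congr 1
    · refine unsh_congr fun A B _ => ?_
      rw [smul_smul, List.length_cons]
      ring_nf
    · refine unsh_congr fun A B _ => ?_
      rw [smul_smul, List.length_cons]
      congr 1
      rw [mul_add, pow_add, mul_one, mul_left_comm, ← mul_pow]
      simp

lemma unsh_of_left_nil (xs : List X) (g : List X → List X → V)
    (h : ∀ A B, A ≠ [] → g A B = 0) : unsh xs g = g [] xs := by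
  induction xs generalizing g with
  | nil => rfl
  | cons x xs ih =>
    rw [unsh_cons, unsh_congr (g' := fun _ _ => 0) fun A B _ => h _ _ (List.cons_ne_nil _ _),
      unsh_zero, zero_add, ih _ fun A B hA => by rw [h _ _ hA, smul_zero]]
    simp

lemma unsh_of_right_nil (xs : List X) (g : List X → List X → V)
    (h : ∀ A B, B ≠ [] → g A B = 0) : unsh xs g = g xs [] := by
  induction xs generalizing g with
  | nil => rfl
  | cons x xs ih =>
    rw [unsh_cons, add_comm, unsh_congr (g' := fun _ _ => 0) fun A B _ => by
      rw [h _ _ (List.cons_ne_nil _ _), smul_zero], unsh_zero, zero_add,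
      ih _ fun A B hA => h _ _ hA]

/-- Three-fold unshuffling: exchange of the first two parts. -/
lemma unsh_unsh_comm (xs : List X) (g : List X → List X → List X → V) :
    unsh xs (fun A C => unsh C fun B C => g A B C)
      = unsh xs (fun B C => unsh C fun A C => (-1 : ℤ) ^ (A.length * B.length) • g A B C) := by
  rw [← unsh_unsh_left, ← unsh_unsh_left]
  exact unsh_congr fun A C _ => by
    rw [unsh_comm]
    exact unsh_congr fun A B _ => by rw [mul_comm]

/-- If `g` changes sign under exchange of adjacent elements in either argument, so does
its sum over unshuffles. -/
lemma unsh_swap (x y : X) (xs ys : List X)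
    (g : List X → List X → V)
    (hA : ∀ A A' B, ((A ++ x :: y :: A') ++ B).Perm (xs ++ x :: y :: ys) →
      g (A ++ x :: y :: A') B = - g (A ++ y :: x :: A') B)
    (hB : ∀ A B B', (A ++ (B ++ x :: y :: B')).Perm (xs ++ x :: y :: ys) →
      g A (B ++ x :: y :: B') = - g A (B ++ y :: x :: B')) :
    unsh (xs ++ x :: y :: ys) g = - unsh (xs ++ y :: x :: ys) g := by
  induction xs generalizing g with
  | nil =>
    simp only [List.nil_append, unsh_cons, neg_add, ← unsh_neg, List.length_cons, smul_smul]
    have h1 : unsh ys (fun A B => g (x :: y :: A) B) = unsh ys fun A B => - g (y :: x :: A) B :=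
      unsh_congr fun A B hp => hA [] A B (by simpa using hp)
    have h2 : unsh ys (fun A B => ((-1 : ℤ) ^ A.length * (-1 : ℤ) ^ A.length) • g A (x :: y :: B))
        = unsh ys fun A B => -(((-1 : ℤ) ^ A.length * (-1 : ℤ) ^ A.length) • g A (y :: x :: B)) :=
      unsh_congr fun A B hp => by
        rw [← smul_neg]
        congr 1
        refine hB A [] B ?_
        simp only [List.nil_append]
        exact (List.perm_middle.trans ((List.perm_middle.trans (hp.cons y)).cons x))
    rw [h1, h2]
    simp only [pow_succ, mul_neg, mul_one, neg_smul, neg_neg]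
    abel
  | cons z zs ih =>
    simp only [List.cons_append, unsh_cons, neg_add]
    congr 1
    · exact ih _ (fun A A' B hp => hA (z :: A) A' B (by simpa using hp))
        fun A B B' hp => hB (z :: A) B B' (by simpa using hp)
    · refine ih _ (fun A A' B hp => ?_) fun A B B' hp => ?_
      · rw [hA A A' (z :: B) (List.perm_middle.trans (hp.cons z))]
        simp
      · have := hB A (z :: B) B' (List.perm_middle.trans (hp.cons z))
        simp only [List.cons_append] at this
        rw [this, smul_neg]

/-- Dependence on one entry: if the functions obtained from `g` by varying one entry of either
argument lie in `S`, so does the function obtained by varying one entry of the sum over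
unshuffles. -/
lemma unsh_slot_mem {Y S : Type*} [SetLike S (Y → V)] [AddSubgroupClass S (Y → V)] (s : S)
    (v : Y → X) (z : X) (xs ys : List X) (g : List X → List X → V)
    (hA : ∀ A A' B, ((A ++ z :: A') ++ B).Perm (xs ++ z :: ys) →
      (fun c => g (A ++ v c :: A') B) ∈ s)
    (hB : ∀ A B B', (A ++ (B ++ z :: B')).Perm (xs ++ z :: ys) →
      (fun c => g A (B ++ v c :: B')) ∈ s) :
    (fun c => unsh (xs ++ v c :: ys) g) ∈ s := by
  induction xs generalizing g with
  | nil =>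
    simp only [List.nil_append, unsh_cons]
    refine add_mem (s := s) (a := fun c => unsh ys fun A B => g (v c :: A) B)
      (b := fun c => unsh ys fun A B => (-1 : ℤ) ^ A.length • g A (v c :: B)) ?_ ?_
    · simp only [← unsh_apply ys fun A B c => g (v c :: A) B]
      exact unsh_mem s fun A B hp => hA [] A B (by simpa using hp)
    · simp only [← unsh_apply ys fun A B c => (-1 : ℤ) ^ A.length • g A (v c :: B)]
      exact unsh_mem s fun A B hp => zsmul_mem
        (hB A [] B (by simpa using List.perm_middle.trans (hp.cons z))) _
  | cons t zs ih =>
    simp only [List.cons_append, unsh_cons]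
    refine add_mem (s := s) (a := fun c => unsh (zs ++ v c :: ys) fun A B => g (t :: A) B)
      (b := fun c => unsh (zs ++ v c :: ys) fun A B => (-1 : ℤ) ^ A.length • g A (t :: B)) ?_ ?_
    · exact ih _ (fun A A' B hp => hA (t :: A) A' B (by simpa using hp))
        fun A B B' hp => hB (t :: A) B B' (by simpa using hp)
    · refine ih _ (fun A A' B hp => ?_) fun A B B' hp => ?_
      · simp only [List.length_append, List.length_cons]
        exact zsmul_mem (hA A A' (t :: B) (List.perm_middle.trans (hp.cons t))) _
      · exact zsmul_mem (hB A (t :: B) B' (List.perm_middle.trans (hp.cons t))) _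

end Unshuffle

/-! ### Functionals on lists of weighted points -/

section Functional

variable {R L M : Type*} [CommRing R] [AddCommGroup M] [Module R M]

/-- The value `∑ r_c φ(c)` of a formal combination `∑ r_c c` of elements of `L` under an
arbitrary map `φ : L → M`. No additivity of `φ` is required, so that the bilinearity of `pair` is
available before any weights are fixed. -/
def pair : (L →₀ R) →ₗ[R] (L → M) →ₗ[R] M := Finsupp.linearCombination R LinearMap.proj

@[simp] lemma pair_single (c : L) (r : R) (φ : L → M) :
    pair (Finsupp.single c r) φ = r • φ c := by
  simp [pair]

lemma pair_pair (u : L →₀ R) (F : L → L →₀ R) (φ : L → M) :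
    pair (pair u F) φ = pair u fun c => pair (F c) φ := by
  induction u using Finsupp.induction_linear with
  | zero => simp
  | add u v hu hv => simp [hu, hv]
  | single c r => simp

lemma pair_comm (u v : L →₀ R) (φ : L → L → M) :
    (pair u fun c => pair v fun d => φ c d) = pair v fun d => pair u fun c => φ c d := by
  induction u using Finsupp.induction_linear with
  | zero =>
    simp only [map_zero, LinearMap.zero_apply]
    exact (map_zero (pair v)).symm
  | add u v hu hv =>
    simp only [map_add, LinearMap.add_apply, hu, hv]
    exact (map_add (pair _) _ _).symm
  | single c r =>
    simp only [pair_single]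
    exact (map_smul (pair v) r fun d => φ c d).symm

lemma pair_add (u : L →₀ R) (φ ψ : L → M) :
    (pair u fun c => φ c + ψ c) = pair u φ + pair u ψ := map_add (pair u) φ ψ

lemma pair_neg (u : L →₀ R) (φ : L → M) : (pair u fun c => - φ c) = - pair u φ :=
  map_neg (pair u) φ

lemma pair_zsmul (n : ℤ) (u : L →₀ R) (φ : L → M) :
    (pair u fun c => n • φ c) = n • pair u φ := map_zsmul (pair u) n φ

lemma pair_zsmul_left (n : ℤ) (u : L →₀ R) (φ : L → M) :
    pair (n • u) φ = n • pair u φ := by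
  rw [map_zsmul, LinearMap.smul_apply]

@[simp] lemma pair_fun_zero (u : L →₀ R) : (pair u fun _ => (0 : M)) = 0 := map_zero (pair u)

lemma pair_unsh_right {X : Type*} (u : L →₀ R) (xs : List X) (g : List X → List X → L → M) :
    (pair u fun c => unsh xs fun A B => g A B c) = unsh xs fun A B => pair u (g A B) := by
  rw [← map_unsh (pair u)]
  congr 1
  exact funext fun c => (unsh_apply xs g c).symm

lemma pair_unsh_left {X : Type*} (xs : List X) (g : List X → List X → L →₀ R) (φ : L → M) :
    pair (unsh xs g) φ = unsh xs fun A B => pair (g A B) φ :=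
  map_unsh (pair.flip φ) xs g

/-- The total weight of a list of weighted points. -/
def wt (xs : List (R × L)) : R := (xs.map Prod.fst).sum

@[simp] lemma wt_nil : wt ([] : List (R × L)) = 0 := rfl
@[simp] lemma wt_cons (x : R × L) (xs : List (R × L)) : wt (x :: xs) = x.1 + wt xs := by
  simp [wt]
@[simp] lemma wt_append (xs ys : List (R × L)) : wt (xs ++ ys) = wt xs + wt ys := by
  simp [wt]
lemma wt_perm {xs ys : List (R × L)} (h : xs.Perm ys) : wt xs = wt ys :=
  (h.map _).sum_eq

variable (R L) in
/-- A functional assigns to a list of weighted points, i.e. of elements of `L` with values of their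
spectral parameters, a formal combination of elements of `L`. -/
abbrev Functional : Type _ := List (R × L) → L →₀ R

/-- The composition of functionals: `G` is evaluated on a sublist `A`, and its value, placed in
front of the complementary list with the weight of `A`, is passed on to `F`. -/
def comp (F G : Functional R L) : Functional R L := fun xs =>
  unsh xs fun A B => pair (G A) fun c => F ((wt A, c) :: B)

/-- The simultaneous insertion of `G` and `H` in two different arguments of `F`. -/
def brace (F G H : Functional R L) : Functional R L := fun xs =>
  unsh xs fun B C => unsh C fun A C => (-1 : ℤ) ^ A.length •
    pair (H B) fun d => pair (G A) fun c => F ((wt A, c) :: (wt B, d) :: C)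

/-- The functional `F` vanishes on lists whose length is not `n`. -/
def HasArity (F : Functional R L) (n : ℕ) : Prop := ∀ xs, xs.length ≠ n → F xs = 0

/-- The failure of associativity of the composition consists of the terms in which `G` and `H`
are inserted in different arguments of `F`. -/
lemma comp_comp (F G H : Functional R L) (xs : List (R × L)) :
    comp (comp F G) H xs = comp F (comp G H) xs + brace F G H xs := by
  have h1 : comp F (comp G H) xs = unsh xs fun A C => unsh C fun B C =>
      pair (H A) fun d => pair (G ((wt A, d) :: B)) fun c => F ((wt A + wt B, c) :: C) := by
    rw [← unsh_unsh_left]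
    refine unsh_congr fun A C _ => ?_
    rw [comp, pair_unsh_left]
    refine unsh_congr fun A' B hp => ?_
    rw [pair_pair, ← wt_perm hp, wt_append]
  rw [h1, brace, ← unsh_add]
  refine unsh_congr fun A C _ => ?_
  simp only [comp, unsh_cons, pair_add, pair_unsh_right, wt_cons, pair_zsmul]

lemma pair_comp (F G : Functional R L) (xs : List (R × L)) (φ : L → M) :
    pair (comp F G xs) φ
      = unsh xs fun A B => pair (G A) fun c => pair (F ((wt A, c) :: B)) φ := by
  rw [comp, pair_unsh_left]
  simp only [pair_pair]

lemma pair_brace (F G H : Functional R L) (xs : List (R × L)) (φ : L → M) :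
    pair (brace F G H xs) φ = unsh xs fun B C => unsh C fun A C => (-1 : ℤ) ^ A.length •
      pair (H B) fun d => pair (G A) fun c => pair (F ((wt A, c) :: (wt B, d) :: C)) φ := by
  rw [brace, pair_unsh_left]
  simp only [pair_unsh_left, pair_pair, pair_zsmul_left]

/-- The first entry of the list goes to `G` or to `H`, since nothing remains for `F` itself. -/
lemma brace_cons {F G H : Functional R L} (hF : HasArity F 2) (x : R × L) (xs : List (R × L)) :
    brace F G H (x :: xs)
      = (unsh xs fun B C => unsh C fun A C => (-1 : ℤ) ^ A.length •
          pair (H (x :: B)) fun d => pair (G A) fun c => F ((wt A, c) :: (x.1 + wt B, d) :: C))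
        + unsh xs fun B C => unsh C fun A C => ((-1 : ℤ) ^ B.length * (-1 : ℤ) ^ (A.length + 1)) •
          pair (H B) fun d => pair (G (x :: A)) fun c =>
            F ((x.1 + wt A, c) :: (wt B, d) :: C) := by
  have h0 : ∀ y z C, F (y :: z :: x :: C) = 0 := fun y z C => hF _ (by simp)
  rw [brace, unsh_cons]
  simp only [wt_cons]
  congr 1
  refine unsh_congr fun B C _ => ?_
  simp only [unsh_cons, h0, pair_fun_zero, smul_zero, unsh_zero, add_zero, ← unsh_zsmul,
    smul_smul, wt_cons, List.length_cons]

/-- If `F` has two arguments, both of which are taken by `G` and `H`, then `P` can only be inserted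
in `G` or in `H`. -/
lemma brace_comp {F G H P : Functional R L} {r p : ℕ} (hF : HasArity F 2)
    (hH : HasArity H (r + 1)) (hP : HasArity P (p + 1)) (xs : List (R × L)) :
    comp (brace F G H) P xs
      = brace F G (comp H P) xs + (-1 : ℤ) ^ (p * r) • brace F (comp G P) H xs := by
  have h1 : brace F G (comp H P) xs = unsh xs fun A C => unsh C fun B C => unsh C fun A' C =>
      (-1 : ℤ) ^ A'.length • pair (P A) fun e => pair (H ((wt A, e) :: B)) fun d =>
        pair (G A') fun c => F ((wt A', c) :: (wt A + wt B, d) :: C) := by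
    rw [← unsh_unsh_left xs fun A B C => unsh C fun A' C => (-1 : ℤ) ^ A'.length • pair (P A)
      fun e => pair (H ((wt A, e) :: B)) fun d =>
        pair (G A') fun c => F ((wt A', c) :: (wt A + wt B, d) :: C)]
    refine unsh_congr fun Q C _ => ?_
    simp only [comp, pair_unsh_left, ← unsh_zsmul]
    rw [unsh_exchange]
    refine unsh_congr fun A B hp => unsh_congr fun A' C' _ => ?_
    rw [pair_pair, ← wt_perm hp, wt_append]
  have h2 : (-1 : ℤ) ^ (p * r) • brace F (comp G P) H xs = unsh xs fun A C => unsh C fun B C =>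
      unsh C fun A' C => ((-1 : ℤ) ^ B.length * (-1 : ℤ) ^ (A'.length + 1)) • pair (P A) fun e =>
        pair (H B) fun d => pair (G ((wt A, e) :: A')) fun c =>
          F ((wt A + wt A', c) :: (wt B, d) :: C) := by
    rw [unsh_unsh_comm, brace, ← unsh_zsmul]
    refine unsh_congr fun B C _ => ?_
    rw [← unsh_zsmul]
    simp only [← unsh_zsmul, smul_smul]
    rw [← unsh_unsh_left]
    refine unsh_congr fun Q C _ => ?_
    simp only [comp, pair_unsh_left, pair_unsh_right, ← unsh_zsmul]
    refine unsh_congr fun A A' hp => ?_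
    by_cases hA : A.length = p + 1
    swap
    · simp [hP A hA]
    by_cases hB : B.length = r + 1
    swap
    · simp [hH B hB]
    simp only [pair_pair]
    rw [pair_comm, ← wt_perm hp, ← hp.length_eq, wt_append, List.length_append]
    congr 1
    rw [hA, hB]
    rcases neg_one_pow_eq_or ℤ p with hi | hi <;> rcases neg_one_pow_eq_or ℤ r with hj | hj <;>
      simp [pow_add, pow_mul, add_mul, mul_add, hi, hj]
  rw [h1, h2, ← unsh_add]
  refine unsh_congr fun A B _ => ?_
  simp only [brace_cons hF, pair_add, pair_unsh_right, pair_zsmul]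

end Functional

/-! ### Conformal functionals -/

section Conformal

variable {R L M : Type*} [CommRing R] [Algebra ℂ R] [AddCommGroup L] [Module ℂ L]
  [Module (Polynomial ℂ) L] [IsScalarTower ℂ (Polynomial ℂ) L]
  [AddCommGroup M] [Module ℂ M] [Module R M] [IsScalarTower ℂ R M]

variable (L M) in
/-- The `ℂ`-linear maps `φ : L → M` of weight `w`, i.e. with `φ (∂ a) = - w φ(a)`. For such `φ`,
the operator `λ_{k+1}† = -∂ - λ₁ - ⋯ - λ_k` becomes multiplication by `t_{k+1}` as soon as `λ_i`
becomes multiplication by `t_i` for `i ≤ k` and `w = t₁ + ⋯ + t_{k+1}`. -/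
def weightSpace (w : R) : Submodule R (L → M) where
  carrier := {φ | (∀ a b, φ (a + b) = φ a + φ b) ∧ (∀ (z : ℂ) a, φ (z • a) = z • φ a) ∧
    ∀ a, φ (partialOp L a) = -(w • φ a)}
  add_mem' := by
    rintro φ ψ ⟨h1, h2, h3⟩ ⟨k1, k2, k3⟩
    refine ⟨fun a b => ?_, fun z a => ?_, fun a => ?_⟩ <;>
      simp only [Pi.add_apply, h1, h2, h3, k1, k2, k3, smul_add]
    · abel
    · abel
  zero_mem' := ⟨by simp, by simp, by simp⟩
  smul_mem' := by
    rintro r φ ⟨h1, h2, h3⟩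
    refine ⟨fun a b => ?_, fun z a => ?_, fun a => ?_⟩ <;>
      simp only [Pi.smul_apply, h1, h2, h3, smul_add, smul_neg]
    · rw [smul_comm]
    · rw [smul_comm]

lemma pair_mem_weightSpace {w : R} (u : L →₀ R) (g : L → L → M) (h : ∀ c, g c ∈ weightSpace L M w) :
    (fun d => pair u fun c => g c d) ∈ weightSpace L M w := by
  have key : (fun d => pair u fun c => g c d) = pair u g := by
    funext d
    induction u using Finsupp.induction_linear with
    | zero => simp
    | add u v hu hv => simp [hu, hv]
    | single c r => simp
  rw [key]
  clear key
  induction u using Finsupp.induction_linear with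
  | zero => simp
  | add u v hu hv =>
    rw [map_add, LinearMap.add_apply]
    exact add_mem hu hv
  | single c r => rw [pair_single]; exact Submodule.smul_mem _ _ (h c)

variable (M) in
/-- A functional is conformal, with respect to the module `M`, if on `M`-valued maps of the
appropriate weight it is linear and sesquilinear in each point, and skew-symmetric. -/
structure IsConformal (F : Functional R L) : Prop where
  slot : ∀ (xs ys : List (R × L)) (t : R) (φ : L → M), φ ∈ weightSpace L M (wt xs + t + wt ys) →
    (fun c => pair (F (xs ++ (t, c) :: ys)) φ) ∈ weightSpace L M t
  skew : ∀ (xs ys : List (R × L)) (x y : R × L) (φ : L → M),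
    φ ∈ weightSpace L M (wt (xs ++ x :: y :: ys)) →
      pair (F (xs ++ x :: y :: ys)) φ = - pair (F (xs ++ y :: x :: ys)) φ

variable (M) in
/-- Equality of the values of two functionals on all `M`-valued maps of the appropriate weight. -/
def Eqv (F G : Functional R L) : Prop :=
  ∀ (xs : List (R × L)) (φ : L → M), φ ∈ weightSpace L M (wt xs) → pair (F xs) φ = pair (G xs) φ

lemma IsConformal.slot_head {F : Functional R L} (hF : IsConformal M F) {w : R}
    {A B xs : List (R × L)} (hp : (A ++ B).Perm xs) {φ : L → M} (hφ : φ ∈ weightSpace L M (wt xs))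
    (hw : w = wt A) :
    (fun c => pair (F ((w, c) :: B)) φ) ∈ weightSpace L M w := by
  refine hF.slot [] B _ φ ?_
  rwa [wt_nil, zero_add, hw, ← wt_append, wt_perm hp]

lemma Eqv.comp {F F' G G' : Functional R L} (hF : Eqv M F F') (hG : Eqv M G G')
    (h : IsConformal M F') : Eqv M (comp F G) (comp F' G') := by
  intro xs φ hφ
  rw [pair_comp, pair_comp]
  refine unsh_congr fun A B hp => ?_
  rw [← hG A _ (h.slot_head hp hφ rfl)]
  congr 1
  funext c
  refine hF _ _ ?_
  rwa [wt_cons, ← wt_append, wt_perm hp]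

lemma IsConformal.comp {F G : Functional R L} (hF : IsConformal M F) (hG : IsConformal M G) :
    IsConformal M (comp F G) where
  slot xs ys t φ hφ := by
    have hφ' : ∀ c : L, φ ∈ weightSpace L M (wt (xs ++ (t, c) :: ys)) := fun c => by
      simpa [add_assoc] using hφ
    simp only [pair_comp]
    refine unsh_slot_mem (weightSpace L M t) (fun c => (t, c)) (t, 0) xs ys _ (fun A A' B hp => ?_)
      fun A B B' hp => ?_
    · simp only [wt_append, wt_cons]
      refine hG.slot A A' t _ ?_
      rw [add_assoc]
      exact hF.slot_head hp (hφ' 0) (by simp)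
    · refine pair_mem_weightSpace _ _ fun c => hF.slot (_ :: B) B' t φ ?_
      convert hφ' 0 using 2
      rw [← wt_perm hp]
      simp [add_assoc]
  skew xs ys x y φ hφ := by
    simp only [pair_comp]
    refine unsh_swap x y xs ys _ (fun A A' B hp => ?_) fun A B B' hp => ?_
    · rw [hG.skew _ _ _ _ _ (hF.slot_head hp hφ rfl)]
      rw [wt_perm (List.Perm.append_left A (List.Perm.swap y x A'))]
    · rw [← pair_neg]
      congr 1
      funext c
      refine hF.skew (_ :: B) B' x y φ ?_
      convert hφ using 2
      rw [← wt_perm hp]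
      simp

/-- The brace of a conformal functional is graded symmetric. -/
lemma brace_symm {F G H : Functional R L} {l r : ℕ} (hF : IsConformal M F)
    (hG : HasArity G (l + 1)) (hH : HasArity H (r + 1)) (xs : List (R × L)) (φ : L → M)
    (hφ : φ ∈ weightSpace L M (wt xs)) :
    pair (brace F G H xs) φ = (-1 : ℤ) ^ (l * r) • pair (brace F H G xs) φ := by
  rw [pair_brace, pair_brace, unsh_unsh_comm, ← unsh_zsmul]
  refine unsh_congr fun A C hp => ?_
  rw [← unsh_zsmul]
  refine unsh_congr fun B C' hp' => ?_
  by_cases hA : A.length = l + 1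
  swap
  · simp [hG A hA]
  by_cases hB : B.length = r + 1
  swap
  · simp [hH B hB]
  rw [pair_comm, smul_smul, smul_smul, ← pair_zsmul, ← pair_zsmul]
  congr 1
  funext c
  rw [← pair_zsmul, ← pair_zsmul]
  congr 1
  funext d
  have hs := hF.skew [] C' (wt A, c) (wt B, d) φ
  rw [List.nil_append, List.nil_append] at hs
  rw [hs]
  · rw [hA, hB, smul_neg, ← neg_smul]
    congr 1
    rcases neg_one_pow_eq_or ℤ l with hi | hi <;> rcases neg_one_pow_eq_or ℤ r with hj | hj <;>
      simp [pow_add, pow_mul, add_mul, mul_add, hi, hj]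
  · convert hφ using 2
    rw [← wt_perm hp, wt_append, ← wt_perm hp']
    simp

end Conformal

/-! ### Shuffle permutations and unshuffles -/

section Shuffle

variable {X V : Type*} [AddCommGroup V]

/-- The permutation of `Fin (n + 1)` which sends `j` to `0` and is `e` on the other elements. -/
def insertPerm {n : ℕ} (j : Fin (n + 1)) (e : Equiv.Perm (Fin n)) : Equiv.Perm (Fin (n + 1)) :=
  Equiv.Perm.decomposeFin.symm (0, e) * j.cycleRange

@[simp] lemma insertPerm_self {n : ℕ} (j : Fin (n + 1)) (e : Equiv.Perm (Fin n)) :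
    insertPerm j e j = 0 := by
  simp [insertPerm]

@[simp] lemma insertPerm_succAbove {n : ℕ} (j : Fin (n + 1)) (e : Equiv.Perm (Fin n)) (i : Fin n) :
    insertPerm j e (j.succAbove i) = (e i).succ := by
  simp [insertPerm]

lemma sign_insertPerm {n : ℕ} (j : Fin (n + 1)) (e : Equiv.Perm (Fin n)) :
    (Equiv.Perm.sign (insertPerm j e) : ℤ) = (-1) ^ (j : ℕ) * Equiv.Perm.sign e := by
  simp [insertPerm, Fin.sign_cycleRange, mul_comm]

lemma insertPerm_bijective (n : ℕ) : Function.Bijective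
    fun q : Fin (n + 1) × Equiv.Perm (Fin n) => insertPerm q.1 q.2 := by
  rw [Fintype.bijective_iff_injective_and_card]
  constructor
  · rintro ⟨j, e⟩ ⟨j', e'⟩ h
    simp only at h
    obtain rfl : j = j' := by
      have h1 : insertPerm j e j = insertPerm j' e' j' := by simp
      rw [← h] at h1
      exact (insertPerm j e).injective h1
    simpa [insertPerm] using h
  · simp [Fintype.card_perm, Nat.factorial_succ]

lemma not_mem_shuffles_insertPerm {n a : ℕ} (j : Fin (n + 1)) (e : Equiv.Perm (Fin n))
    (h0 : j ≠ 0) (ha : j.val ≠ a) : insertPerm j e ∉ shuffles a (n + 1) := by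
  intro h
  simp only [shuffles, Finset.mem_filter, Finset.mem_univ, true_and] at h
  have hj : 0 < j.val := Nat.pos_of_ne_zero fun h => h0 (Fin.ext h)
  have := h ⟨j.val - 1, by omega⟩ j (Fin.lt_def.2 (Nat.sub_lt hj one_pos)) (by simp only; omega)
  simp at this

lemma mem_shuffles_insertPerm_zero {n a : ℕ} (e : Equiv.Perm (Fin n)) :
    insertPerm 0 e ∈ shuffles (a + 1) (n + 1) ↔ e ∈ shuffles a n := by
  have h0 : ∀ i, insertPerm 0 e i.succ = (e i).succ := fun i => insertPerm_succAbove 0 e i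
  simp [shuffles, Fin.forall_fin_succ, h0]

lemma mem_shuffles_insertPerm_block {n a : ℕ} (j : Fin (n + 1)) (hj : j.val = a)
    (e : Equiv.Perm (Fin n)) : insertPerm j e ∈ shuffles a (n + 1) ↔ e ∈ shuffles a n := by
  have h1 : ∀ i : Fin n, (j.succAbove i).val < a ↔ i.val < a := fun i => by
    subst hj; simp only [Fin.succAbove, Fin.lt_def]; split_ifs <;> (simp at *; try omega)
  simp only [shuffles, Finset.mem_filter, Finset.mem_univ, true_and]
  constructor
  · intro h u v huv hc
    simpa using h (j.succAbove u) (j.succAbove v) (by simpa using huv)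
      (by rwa [h1, ← not_lt, h1, not_lt])
  · intro h u v huv hc
    rcases Fin.eq_self_or_eq_succAbove j v with rfl | ⟨v, rfl⟩
    · rw [Fin.lt_def] at huv
      omega
    rcases Fin.eq_self_or_eq_succAbove j u with rfl | ⟨u, rfl⟩
    · simp
    · simpa using h u v (by simpa using huv) (by rwa [h1, ← not_lt, h1, not_lt] at hc)

lemma ofFn_eq_take_append_drop {n : ℕ} (F : Fin (n + 1) → X) (j : Fin (n + 1)) :
    List.ofFn F = (List.ofFn fun i => F (j.succAbove i)).take j ++
      F j :: (List.ofFn fun i => F (j.succAbove i)).drop j := by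
  induction n with
  | zero =>
    obtain rfl : j = 0 := Fin.fin_one_eq_zero j
    simp
  | succ n ih =>
    cases j using Fin.cases with
    | zero => simp [List.ofFn_succ]
    | succ j =>
      rw [List.ofFn_succ, ih _ j, List.ofFn_succ (n := n)]
      simp

/-- The sum over shuffles, both blocks being read off the permuted list. A permutation `τ` is
determined by `j = τ⁻¹(0)` and the permutation of the other elements; it is a shuffle only if `j` is
the first element of one of the two blocks, and then it arises from a shuffle of one element less.
These two cases are the two terms in the recursion of `unsh`. -/
lemma sum_shuffles_take_drop {n a : ℕ} (ha : a ≤ n) (x : Fin n → X) (g : List X → List X → V) :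
    ∑ τ ∈ shuffles a n, (Equiv.Perm.sign τ : ℤ) •
        g ((List.ofFn fun i => x (τ i)).take a) ((List.ofFn fun i => x (τ i)).drop a)
      = unsh (List.ofFn x) fun A B => if A.length = a then g A B else 0 := by
  induction n generalizing a g with
  | zero =>
    obtain rfl : a = 0 := by omega
    simp [shuffles]
  | succ n ih =>
    have hmem : ∀ (m : ℕ) (s : Finset (Equiv.Perm (Fin m))) (F : Equiv.Perm (Fin m) → V),
        ∑ τ ∈ s, F τ = ∑ τ, if τ ∈ s then F τ else 0 := by simp
    have hsum : ∀ F : Equiv.Perm (Fin (n + 1)) → V, ∑ τ ∈ shuffles a (n + 1), F τ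
        = ∑ j : Fin (n + 1), ∑ e : Equiv.Perm (Fin n),
          if insertPerm j e ∈ shuffles a (n + 1) then F (insertPerm j e) else 0 := fun F => by
      rw [hmem, ← Fintype.sum_prod_type',
        ← (Equiv.ofBijective _ (insertPerm_bijective n)).sum_comp]
      rfl
    have hblock : ∀ j : Fin (n + 1), j.val = a → (∑ e : Equiv.Perm (Fin n),
        if insertPerm j e ∈ shuffles a (n + 1) then (Equiv.Perm.sign (insertPerm j e) : ℤ) •
          g ((List.ofFn fun i => x (insertPerm j e i)).take a)
            ((List.ofFn fun i => x (insertPerm j e i)).drop a) else 0)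
        = unsh (List.ofFn fun i => x i.succ) fun A B => (-1 : ℤ) ^ A.length •
          if A.length = a then g A (x 0 :: B) else 0 := fun j hj => by
      have ha' : a ≤ n := by omega
      simp only [smul_ite, smul_zero]
      rw [← ih ha', hmem _ (shuffles a n)]
      refine Finset.sum_congr rfl fun e _ => ?_
      simp only [mem_shuffles_insertPerm_block j hj]
      refine if_congr Iff.rfl ?_ rfl
      rw [ofFn_eq_take_append_drop _ j]
      simp only [insertPerm_self, insertPerm_succAbove, hj, sign_insertPerm]
      rw [List.take_left' (by simpa using ha'), List.drop_left' (by simpa using ha'), smul_smul,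
        mul_comm]
      simp [ha']
    have hzero : ∀ j : Fin (n + 1), j ≠ 0 → j.val ≠ a → (∑ e : Equiv.Perm (Fin n),
        if insertPerm j e ∈ shuffles a (n + 1) then (Equiv.Perm.sign (insertPerm j e) : ℤ) •
          g ((List.ofFn fun i => x (insertPerm j e i)).take a)
            ((List.ofFn fun i => x (insertPerm j e i)).drop a) else 0) = 0 := fun j h0 hj => by
      simp [not_mem_shuffles_insertPerm j _ h0 hj]
    rw [hsum, List.ofFn_succ, unsh_cons]
    cases a with
    | zero =>
      rw [Finset.sum_eq_single 0 (fun j _ h0 => hzero j h0 fun h => h0 (Fin.ext h)) (by simp),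
        hblock 0 (by simp)]
      simp
    | succ a =>
      have ha' : a ≤ n := by omega
      have hfirst : (∑ e : Equiv.Perm (Fin n),
          if insertPerm 0 e ∈ shuffles (a + 1) (n + 1) then
            (Equiv.Perm.sign (insertPerm 0 e) : ℤ) •
              g ((List.ofFn fun i => x (insertPerm 0 e i)).take (a + 1))
                ((List.ofFn fun i => x (insertPerm 0 e i)).drop (a + 1)) else 0)
          = unsh (List.ofFn fun i => x i.succ) fun A B =>
            if A.length = a then g (x 0 :: A) B else 0 := by
        rw [← ih ha' _ fun A B => g (x 0 :: A) B, hmem _ (shuffles a n)]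
        refine Finset.sum_congr rfl fun e _ => ?_
        simp only [mem_shuffles_insertPerm_zero]
        refine if_congr Iff.rfl ?_ rfl
        have h1 : ∀ i, insertPerm 0 e i.succ = (e i).succ := fun i => insertPerm_succAbove 0 e i
        simp [List.ofFn_succ, h1, sign_insertPerm]
      simp only [List.length_cons, add_left_inj]
      rcases eq_or_lt_of_le ha' with rfl | ha''
      · -- all elements belong to the first block, and the second sum has no terms
        rw [Finset.sum_eq_single 0 (fun j _ h0 => hzero j h0 (by omega)) (by simp), hfirst,
          unsh_congr (g := fun A B => (-1 : ℤ) ^ A.length • _) (g' := fun _ _ => 0), unsh_zero,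
          add_zero]
        intro A B hp
        have := hp.length_eq
        simp only [List.length_append, List.length_ofFn] at this
        rw [if_neg (by omega), smul_zero]
      · have h0 : (0 : Fin (n + 1)) ≠ ⟨a + 1, by omega⟩ := by simp [Fin.ext_iff]
        rw [Fintype.sum_eq_add 0 ⟨a + 1, by omega⟩ h0
          fun j hj => hzero j hj.1 fun h => hj.2 (Fin.ext h), hfirst,
          hblock ⟨a + 1, by omega⟩ rfl]

/-- Sums over shuffle permutations are signed sums over unshuffles. -/
lemma sum_shuffles {a b n : ℕ} (h : a + b = n) (x : Fin n → X) (g : List X → List X → V) :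
    ∑ τ ∈ shuffles a n, (Equiv.Perm.sign τ : ℤ) •
        g (List.ofFn fun i => x (τ (fstBlock h i))) (List.ofFn fun j => x (τ (sndBlock h j)))
      = unsh (List.ofFn x) fun A B => if A.length = a then g A B else 0 := by
  rw [← sum_shuffles_take_drop (by omega)]
  refine Finset.sum_congr rfl fun τ _ => ?_
  congr 2
  · subst h
    rw [List.ofFn_add]
    simp [fstBlock]
    rfl
  · subst h
    rw [List.ofFn_add]
    simp [sndBlock]

end Shuffle

/-! ### Evaluation of cochains at weighted points -/

section Eval

variable {R L M : Type*} [CommRing R] [AddCommGroup L] [AddCommGroup M] [Module R M]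

/-- The value `∑ t^α φ(a_α)` of a polynomial `∑ λ^α a_α` at elements `t₁, …, t_k` of `R`, the
coefficients being transported to `M` by `φ`. The family `t` has `k + 1` members, the last of
which plays no role. -/
def evalAt {k : ℕ} (t : Fin (k + 1) → R) (φ : L → M) (P : LPoly L k) : M :=
  P.sum fun α a => (∏ i, t i.castSucc ^ α i) • φ a

/-- The functional which evaluates a cochain of degree `k + 1` on lists of length `k + 1`. The
last weight in the list enters only through the weight of the maps with which the value is
paired. -/
def functional {k : ℕ} (f : PreCochain L k) : Functional R L := fun xs =>
  if xs.length = k + 1 then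
    evalAt (fun i : Fin (k + 1) => (xs.getD i 0).1) (fun a => Finsupp.single a 1)
      (f fun i => (xs.getD i 0).2)
  else 0

lemma functional_hasArity {k : ℕ} (f : PreCochain L k) :
    HasArity (functional f : Functional R L) (k + 1) := fun _ h => if_neg h

lemma pair_evalAt {k : ℕ} (t : Fin (k + 1) → R) (g : L → L →₀ R) (φ : L → M) (P : LPoly L k) :
    pair (evalAt t g P) φ = evalAt t (fun a => pair (g a) φ) P := by
  simp only [evalAt, Finsupp.sum, map_sum, map_smul, LinearMap.coe_sum, Finset.sum_apply,
    LinearMap.smul_apply]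

lemma pair_functional_ofFn {k : ℕ} (f : PreCochain L k) (x : Fin (k + 1) → R × L) (φ : L → M) :
    pair (functional f (List.ofFn x)) φ = evalAt (fun i => (x i).1) φ (f fun i => (x i).2) := by
  have h : ∀ i : Fin (k + 1), (List.ofFn x).getD i 0 = x i := fun i => by
    rw [List.getD_eq_getElem _ _ (by simp only [List.length_ofFn, i.isLt]), List.getElem_ofFn]
  rw [functional, if_pos (by simp), pair_evalAt]
  simp only [h, pair_single, one_smul]

lemma pair_functional_cons_ofFn {k : ℕ} (f : PreCochain L k) (y : R × L) (x : Fin k → R × L)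
    (φ : L → M) : pair (functional f (y :: List.ofFn x)) φ
      = evalAt (Fin.cons y.1 fun i => (x i).1) φ (f (Fin.cons y.2 fun i => (x i).2)) := by
  rw [← List.ofFn_cons, pair_functional_ofFn]
  congr 2
  · funext i
    cases i using Fin.cases <;> rfl
  · funext i
    cases i using Fin.cases <;> rfl

lemma pair_functional_two (f : PreCochain L 1) (y z : R × L) (φ : L → M) :
    pair (functional f [y, z]) φ = evalAt ![y.1, z.1] φ (f ![y.2, z.2]) := by
  have := pair_functional_cons_ofFn f y (fun _ => z) φ
  simp only [List.ofFn_succ, List.ofFn_zero] at this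
  rw [this]
  congr 2 <;>
  · funext i
    fin_cases i <;> rfl

lemma evalAt_single {k : ℕ} (t : Fin (k + 1) → R) {φ : L → M} (h0 : φ 0 = 0) (α : Fin k →₀ ℕ)
    (a : L) : evalAt t φ (Finsupp.single α a) = (∏ i, t i.castSucc ^ α i) • φ a := by
  simp [evalAt, h0]

/-- Evaluation of a substitution at operators which become multiplications by `r i`. -/
lemma map_subst [Module ℂ M] {n : ℕ} {N : Type*} [AddCommGroup N] [Module ℂ N]
    (e : N →ₗ[ℂ] M)
    (T : Fin n → Module.End ℂ N) (r : Fin (n + 1) → R)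
    (hT : ∀ i P, e (T i P) = r i.castSucc • e P) (g : L → N) (P : LPoly L n) :
    e (subst T g P) = evalAt r (fun a => e (g a)) P := by
  have hpow : ∀ i m P, e ((T i ^ m) P) = r i.castSucc ^ m • e P := fun i m P => by
    induction m with
    | zero => simp
    | succ m ih => rw [pow_succ', Module.End.mul_apply, hT, ih, pow_succ', mul_smul]
  have hprod : ∀ (l : List (Fin n)) (α : Fin n →₀ ℕ) P, e ((l.map fun i => T i ^ α i).prod P)
      = (l.map fun i => r i.castSucc ^ α i).prod • e P := fun l α P => by
    induction l with
    | nil => simp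
    | cons i l ih => simp [Module.End.mul_apply, hpow, ih, mul_smul]
  simp only [subst, evalAt, Finsupp.sum, map_sum]
  refine Finset.sum_congr rfl fun α _ => ?_
  rw [List.ofFn_eq_map, hprod, ← List.ofFn_eq_map, List.prod_ofFn]

end Eval

section EvalWeight

variable {R L M : Type*} [CommRing R] [Algebra ℂ R] [AddCommGroup L] [Module ℂ L]
  [Module (Polynomial ℂ) L] [IsScalarTower ℂ (Polynomial ℂ) L]
  [AddCommGroup M] [Module ℂ M] [Module R M] [IsScalarTower ℂ R M]

lemma weightSpace_add {w : R} {φ : L → M} (h : φ ∈ weightSpace L M w) (a b : L) :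
    φ (a + b) = φ a + φ b :=
  h.1 a b

lemma weightSpace_zero {w : R} {φ : L → M} (h : φ ∈ weightSpace L M w) : φ 0 = 0 := by
  simpa using weightSpace_add h 0 0

/-- Evaluation as a `ℂ`-linear map. -/
def evalHom {k : ℕ} (t : Fin (k + 1) → R) {w : R} {φ : L → M} (h : φ ∈ weightSpace L M w) :
    LPoly L k →ₗ[ℂ] M where
  toFun := evalAt t φ
  map_add' P Q := Finsupp.sum_add_index' (fun α => by simp [weightSpace_zero h])
    fun α a b => by rw [weightSpace_add h, smul_add]
  map_smul' z P := by
    simp only [evalAt]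
    rw [Finsupp.sum_smul_index' fun α => by simp [weightSpace_zero h], Finsupp.smul_sum]
    refine Finsupp.sum_congr fun α _ => ?_
    rw [h.2.1, RingHom.id_apply, smul_comm]

@[simp] lemma evalHom_apply {k : ℕ} (t : Fin (k + 1) → R) {w : R} {φ : L → M}
    (h : φ ∈ weightSpace L M w) (P : LPoly L k) : evalHom t h P = evalAt t φ P := rfl

variable {k : ℕ} {t : Fin (k + 1) → R} {φ : L → M}

lemma evalAt_onCoeff {w : R} (h : φ ∈ weightSpace L M w) (T : Module.End ℂ L) (P : LPoly L k) :
    evalAt t φ (onCoeff T P) = evalAt t (fun a => φ (T a)) P := by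
  simp only [evalAt, onCoeff, Finsupp.mapRange.linearMap_apply]
  exact Finsupp.sum_mapRange_index fun α => by simp [weightSpace_zero h]

lemma evalAt_lam {w : R} (h : φ ∈ weightSpace L M w) (i : Fin k) (P : LPoly L k) :
    evalAt t φ (lam i P) = t i.castSucc • evalAt t φ P := by
  rw [← evalHom_apply t h, ← evalHom_apply t h]
  induction P using Finsupp.induction_linear with
  | zero => simp only [map_zero, smul_zero]
  | add P Q hP hQ => rw [map_add, map_add, hP, hQ, map_add, smul_add]
  | single α a =>
    simp only [evalHom_apply, lam, Finsupp.lmapDomain_apply, Finsupp.mapDomain_single]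
    rw [evalAt_single t (weightSpace_zero h), evalAt_single t (weightSpace_zero h), smul_smul]
    congr 1
    simp only [Finsupp.add_apply, pow_add, Finset.prod_mul_distrib]
    rw [mul_comm]
    congr 1
    rw [Finset.prod_eq_single i] <;> simp +contextual [eq_comm]

/-- Under evaluation by a map whose weight is the sum of all `t i`, every spectral operator,
including `λ_{k+1}†`, becomes multiplication by the corresponding `t i`. -/
lemma evalAt_specOp (h : φ ∈ weightSpace L M (∑ i, t i)) (i : Fin (k + 1)) (P : LPoly L k) :
    evalAt t φ (specOp i P) = t i • evalAt t φ P := by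
  cases i using Fin.lastCases with
  | cast i => simpa [specOp] using evalAt_lam h i P
  | last =>
    have h1 : evalAt t φ (onCoeff (partialOp L) P) = -((∑ i, t i) • evalAt t φ P) := by
      rw [evalAt_onCoeff h]
      simp only [evalAt, Finsupp.sum, Finset.smul_sum, h.2.2, smul_neg, Finset.sum_neg_distrib]
      congr 1
      refine Finset.sum_congr rfl fun α _ => ?_
      rw [smul_comm]
    have h2 := fun i => evalAt_lam (t := t) h i P
    simp only [specOp, Fin.lastCases_last, lamDagger, ← evalHom_apply t h, map_sub,
      LinearMap.sub_apply, LinearMap.neg_apply, map_neg, LinearMap.coe_sum, Finset.sum_apply,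
      map_sum] at h1 h2 ⊢
    rw [h1]
    simp only [h2]
    generalize evalHom t h P = Q
    rw [Fin.sum_univ_castSucc, add_smul, Finset.sum_smul]
    abel

lemma evalAt_sum_specOp {ι : Type*} (s : Finset ι) (ρ : ι → Fin (k + 1))
    (h : φ ∈ weightSpace L M (∑ i, t i)) (P : LPoly L k) :
    evalAt t φ ((∑ i ∈ s, specOp (ρ i) : Module.End ℂ (LPoly L k)) P)
      = (∑ i ∈ s, t (ρ i)) • evalAt t φ P := by
  rw [← evalHom_apply t h, LinearMap.sum_apply, map_sum, Finset.sum_smul]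
  exact Finset.sum_congr rfl fun i _ => evalAt_specOp h _ _

lemma evalAt_const {w : R} (h : φ ∈ weightSpace L M w) (a : L) : evalAt t φ (const k a) = φ a := by
  rw [const, evalAt_single t (weightSpace_zero h)]
  simp

lemma evalAt_subst {n : ℕ} (h : φ ∈ weightSpace L M (∑ i, t i))
    (T : Fin n → Module.End ℂ (LPoly L k)) (r : Fin (n + 1) → R)
    (hT : ∀ i P, evalAt t φ (T i P) = r i.castSucc • evalAt t φ P) (g : L → LPoly L k)
    (P : LPoly L n) : evalAt t φ (subst T g P) = evalAt r (fun a => evalAt t φ (g a)) P :=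
  map_subst (evalHom t h) T r hT g P

lemma evalAt_at {n : ℕ} (h : φ ∈ weightSpace L M (∑ i, t i)) (f : PreCochain L n)
    (T : Fin (n + 1) → Module.End ℂ (LPoly L k)) (r : Fin (n + 1) → R)
    (hT : ∀ i P, evalAt t φ (T i P) = r i • evalAt t φ P) (p : Fin (n + 1) → L) :
    evalAt t φ (f.at T p) = evalAt r φ (f p) := by
  rw [PreCochain.at, evalAt_subst h _ r fun i P => hT _ P]
  simp only [evalAt_const h]

end EvalWeight

/-! ### Lists obtained from finite families -/

section Lists

variable {X : Type*}

/-- Exchanging two neighbours in a family exchanges two neighbours in the list of its values. -/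
lemma ofFn_swap {n : ℕ} (z : Fin (n + 1) → X) (i : Fin n) : ∃ xs ys, xs.length = (i : ℕ) ∧
    List.ofFn z = xs ++ z i.castSucc :: z i.succ :: ys ∧
    List.ofFn (fun j => z (Equiv.swap i.castSucc i.succ j))
      = xs ++ z i.succ :: z i.castSucc :: ys := by
  induction n with
  | zero => exact i.elim0
  | succ n ih =>
    cases i using Fin.cases with
    | zero =>
      refine ⟨[], List.ofFn fun j => z j.succ.succ, rfl, ?_, ?_⟩
      · simp [List.ofFn_succ]
      · have h : ∀ j : Fin n, Equiv.swap (0 : Fin (n + 2)) 1 j.succ.succ = j.succ.succ := fun j =>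
          Equiv.swap_apply_of_ne_of_ne (Fin.succ_ne_zero _)
            (by
              rw [← Fin.succ_zero_eq_one]
              exact fun h => Fin.succ_ne_zero _ (Fin.succ_injective _ h))
        simp [List.ofFn_succ, h]
    | succ i =>
      obtain ⟨xs, ys, h1, h2, h3⟩ := ih (fun j => z j.succ) i
      refine ⟨z 0 :: xs, ys, by simp [h1], ?_, ?_⟩
      · rw [List.ofFn_succ, h2]
        simp
      · have h : ∀ j : Fin (n + 1), Equiv.swap i.succ.castSucc i.succ.succ j.succ
            = (Equiv.swap i.castSucc i.succ j).succ := fun j => by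
          rw [← Fin.succ_castSucc]
          exact ((Fin.succ_injective _).map_swap _ _ _).symm
        rw [List.ofFn_succ]
        simp only [h, h3]
        rw [Equiv.swap_apply_of_ne_of_ne] <;> simp [Fin.ext_iff]

lemma ofFn_update {n : ℕ} (z : Fin n → X) (i : Fin n) : ∃ xs ys, xs.length = (i : ℕ) ∧
    ∀ v, List.ofFn (Function.update z i v) = xs ++ v :: ys := by
  induction n with
  | zero => exact i.elim0
  | succ n ih =>
    cases i using Fin.cases with
    | zero => exact ⟨[], List.ofFn fun j => z j.succ, rfl, fun v => by simp [List.ofFn_succ]⟩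
    | succ i =>
      obtain ⟨xs, ys, h1, h2⟩ := ih (fun j => z j.succ) i
      refine ⟨z 0 :: xs, ys, by simp [h1], fun v => ?_⟩
      rw [List.ofFn_succ, Function.update_of_ne (Fin.succ_ne_zero i).symm]
      rw [List.cons_append, ← h2 v]
      congr 2
      funext j
      simp [Function.update_apply]

lemma eq_ofFn_of_length {n : ℕ} {xs : List X} (h : xs.length = n) :
    ∃ z : Fin n → X, xs = List.ofFn z := by
  subst h
  exact ⟨xs.get, (List.ofFn_get xs).symm⟩

lemma wt_ofFn {R L : Type*} [CommRing R] {n : ℕ} (x : Fin n → R × L) :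
    wt (List.ofFn x) = ∑ i, (x i).1 := by
  rw [wt, List.map_ofFn, List.sum_ofFn]
  rfl

end Lists

/-! ### The operators `λ₁, …, λ_k, λ_{k+1}†` as elements of a commutative ring -/

section Environment

variable {L : Type u} [AddCommGroup L] [Module ℂ L] [Module (Polynomial ℂ) L]
  [IsScalarTower ℂ (Polynomial ℂ) L]

lemma commute_specOp {N : ℕ} (i j : Fin (N + 1)) :
    Commute (specOp i : Module.End ℂ (LPoly L N)) (specOp j) := by
  have h1 : ∀ i j : Fin N, Commute (lam i : Module.End ℂ (LPoly L N)) (lam j) := fun i j => by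
    refine Finsupp.lhom_ext fun α a => ?_
    simp [lam, Module.End.mul_apply, Finsupp.mapDomain_single, add_right_comm]
  have h2 : ∀ i : Fin N, Commute (onCoeff (partialOp L) : Module.End ℂ (LPoly L N)) (lam i) :=
    fun i => by
      refine Finsupp.lhom_ext fun α a => ?_
      simp [lam, onCoeff, Module.End.mul_apply, Finsupp.mapDomain_single]
  have h3 : ∀ i : Fin N, Commute (lamDagger N : Module.End ℂ (LPoly L N)) (lam i) := fun i =>
    (h2 i).neg_left.sub_left (Commute.sum_left _ _ _ fun j _ => h1 j i)
  cases i using Fin.lastCases with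
  | cast i =>
    cases j using Fin.lastCases with
    | cast j => simpa [specOp] using h1 i j
    | last => simpa [specOp] using (h3 i).symm
  | last =>
    cases j using Fin.lastCases with
    | cast j => simpa [specOp] using h3 j
    | last => exact Commute.refl _

open scoped IsMulCommutative in
variable (L) in
/-- The operators `λ₁, …, λ_N, λ_{N+1}†` are the multiplications by elements of a commutative
algebra acting on `L[λ₁,…,λ_N]`. -/
lemma exists_commRing_specOp (N : ℕ) : ∃ (R : Type u) (_ : CommRing R) (_ : Algebra ℂ R)
    (_ : Module R (LPoly L N)) (_ : IsScalarTower ℂ R (LPoly L N)) (t : Fin (N + 1) → R),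
    ∀ i (P : LPoly L N), t i • P = specOp i P := by
  obtain ⟨S, hS, _⟩ : ∃ S : Subalgebra ℂ (Module.End ℂ (LPoly L N)),
      (∀ i, specOp i ∈ S) ∧ IsMulCommutative S :=
    ⟨Algebra.adjoin ℂ (Set.range specOp), fun i => Algebra.subset_adjoin ⟨i, rfl⟩,
      Algebra.isMulCommutative_adjoin ℂ (by
        rintro _ ⟨i, rfl⟩ _ ⟨j, rfl⟩
        exact commute_specOp i j)⟩
  exact ⟨S, inferInstance, inferInstance, inferInstance, inferInstance,
    fun i => ⟨specOp i, hS i⟩, fun i P => rfl⟩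

variable {N : ℕ} {R : Type u} [CommRing R] [Algebra ℂ R] [Module R (LPoly L N)]
  [IsScalarTower ℂ R (LPoly L N)] {t : Fin (N + 1) → R}

lemma const_mem_weightSpace (ht : ∀ i (P : LPoly L N), t i • P = specOp i P) :
    const N ∈ weightSpace L (LPoly L N) (∑ i, t i) := by
  refine ⟨fun a b => Finsupp.single_add _ _ _, fun z a => (Finsupp.smul_single _ _ _).symm,
    fun a => ?_⟩
  rw [Finset.sum_smul]
  simp only [ht]
  rw [Fin.sum_univ_castSucc]
  simp [specOp, lamDagger, onCoeff, const]

/-- Evaluating a polynomial at the spectral operators themselves gives the polynomial back. -/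
lemma evalAt_const_self (ht : ∀ i (P : LPoly L N), t i • P = specOp i P) (P : LPoly L N) :
    evalAt t (const N) P = P := by
  have hg := const_mem_weightSpace ht
  rw [← evalHom_apply t hg]
  induction P using Finsupp.induction_linear with
  | zero => simp only [map_zero]
  | add P Q hP hQ => rw [map_add, hP, hQ]
  | single α a =>
    rw [evalHom_apply, evalAt_single t (weightSpace_zero hg)]
    have h1 : ∀ (i : Fin N) (m : ℕ) (β : Fin N →₀ ℕ), t i.castSucc ^ m •
        (Finsupp.single β a : LPoly L N) = Finsupp.single (β + Finsupp.single i m) a := by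
      intro i m β
      induction m with
      | zero => simp
      | succ m ih =>
        rw [pow_succ', mul_smul, ih, ht]
        simp [specOp, lam, Finsupp.mapDomain_single, add_assoc]
    have h2 : ∀ s : Finset (Fin N), (∏ i ∈ s, t i.castSucc ^ α i) •
        (Finsupp.single 0 a : LPoly L N)
          = Finsupp.single (∑ i ∈ s, Finsupp.single i (α i)) a := by
      intro s
      induction s using Finset.induction_on with
      | empty => simp
      | insert i s hi ih =>
        rw [Finset.prod_insert hi, mul_smul, ih, h1, Finset.sum_insert hi, add_comm]
    rw [const, h2, Finsupp.univ_sum_single]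

lemma pair_functional_specOp (ht : ∀ i (P : LPoly L N), t i • P = specOp i P) (f : PreCochain L N)
    (p : Fin (N + 1) → L) :
    pair (functional f (List.ofFn fun i => (t i, p i))) (const N) = f p := by
  rw [pair_functional_ofFn]
  exact evalAt_const_self ht (f p)

/-- A map `L^{N+1} → L[λ₁,…,λ_N]` is determined by its functionals. -/
lemma PreCochain.ext_functional {f g : PreCochain L N}
    (H : ∀ (R : Type u) [CommRing R] [Algebra ℂ R] [Module R (LPoly L N)]
      [IsScalarTower ℂ R (LPoly L N)],
      Eqv (R := R) (LPoly L N) (functional f) (functional g)) : f = g := by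
  obtain ⟨R, _, _, _, _, t, ht⟩ := exists_commRing_specOp L N
  funext p
  rw [← pair_functional_specOp ht f p, ← pair_functional_specOp ht g p]
  refine H R _ _ ?_
  rw [wt_ofFn]
  exact const_mem_weightSpace ht

end Environment

/-! ### Cochains and conformal functionals -/

section Cochain

variable {L : Type u} [AddCommGroup L] [Module ℂ L] [Module (Polynomial ℂ) L]
  [IsScalarTower ℂ (Polynomial ℂ) L]

section

variable {R M : Type*} [CommRing R] [Algebra ℂ R]
  [AddCommGroup M] [Module ℂ M] [Module R M] [IsScalarTower ℂ R M]

lemma Eqv.symm {F G : Functional R L} (h : Eqv M F G) : Eqv M G F :=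
  fun xs φ hφ => (h xs φ hφ).symm

lemma Eqv.trans {F G H : Functional R L} (h : Eqv M F G) (h' : Eqv M G H) : Eqv M F H :=
  fun xs φ hφ => (h xs φ hφ).trans (h' xs φ hφ)

lemma IsConformal.congr {F G : Functional R L} (hF : IsConformal M F) (h : Eqv M G F) :
    IsConformal M G where
  slot xs ys t φ hφ := by
    convert hF.slot xs ys t φ hφ using 1
    funext c
    exact h _ _ (by simpa [add_assoc] using hφ)
  skew xs ys x y φ hφ := by
    rw [h _ _ hφ, hF.skew _ _ _ _ _ hφ, h]
    rwa [wt_perm (List.Perm.append_left xs (List.Perm.swap x y ys))]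

/-- The behaviour of a conformal functional under arbitrary permutations. -/
lemma IsConformal.perm {F : Functional R L} (hF : IsConformal M F) {n : ℕ}
    (x : Fin (n + 1) → R × L) (φ : L → M) (hφ : φ ∈ weightSpace L M (∑ i, (x i).1))
    (σ : Equiv.Perm (Fin (n + 1))) :
    pair (F (List.ofFn fun i => x (σ i))) φ
      = (Equiv.Perm.sign σ : ℤ) • pair (F (List.ofFn x)) φ := by
  have hσ : σ ∈ Submonoid.closure
      (Set.range fun i : Fin n => Equiv.swap i.castSucc i.succ) := by
    rw [Equiv.Perm.mclosure_swap_castSucc_succ]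
    trivial
  induction hσ using Submonoid.closure_induction generalizing x with
  | mem σ h =>
    obtain ⟨i, rfl⟩ := h
    obtain ⟨xs, ys, -, h1, h2⟩ := ofFn_swap x i
    rw [h1, h2, hF.skew, Equiv.Perm.sign_swap (Fin.castSucc_lt_succ).ne]
    · simp
    · rw [← h2, wt_ofFn, Equiv.sum_comp (Equiv.swap i.castSucc i.succ) fun j => (x j).1]
      exact hφ
  | one => simp
  | mul σ τ _ _ hσ hτ =>
    have h1 := hτ (fun i => x (σ i)) (by rwa [Equiv.sum_comp σ fun j => (x j).1])
    simp only [Equiv.Perm.mul_apply]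
    rw [h1, hσ x hφ, smul_smul, map_mul]
    push_cast
    rw [mul_comm]

/-- The functional of a cochain is conformal. -/
lemma functional_isConformal {k : ℕ} (f : cochains L k) :
    IsConformal M (functional (R := R) f.1) where
  slot xs ys t φ hφ := by
    by_cases hn : (xs ++ (t, (0 : L)) :: ys).length = k + 1
    swap
    · have h0 : ∀ c : L, functional (R := R) f.1 (xs ++ (t, c) :: ys) = 0 := fun c =>
        functional_hasArity _ _ (by simpa using hn)
      simp only [h0, map_zero, LinearMap.zero_apply]
      exact Submodule.zero_mem _
    obtain ⟨z, hz⟩ := eq_ofFn_of_length hn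
    have hlen : xs.length < k + 1 := by rw [← hn]; simp
    obtain ⟨xs', ys', h1, h2⟩ := ofFn_update z ⟨xs.length, hlen⟩
    have h3 := h2 (z ⟨xs.length, hlen⟩)
    rw [Function.update_eq_self, ← hz] at h3
    obtain ⟨rfl, h4⟩ := List.append_inj h3 h1.symm
    obtain ⟨h5, rfl⟩ := List.cons_eq_cons.1 h4
    set i : Fin (k + 1) := ⟨xs.length, hlen⟩
    have h6 : ∀ c : L, pair (functional f.1 (xs ++ (t, c) :: ys)) φ
        = evalAt (fun j => (z j).1) φ (f.1 (Function.update (fun j => (z j).2) i c)) := fun c => by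
      rw [← h2, pair_functional_ofFn]
      have e1 : ∀ j, (Function.update z i (t, c) j).1 = (z j).1 := fun j => by
        rcases eq_or_ne j i with rfl | hj
        · simp [← h5]
        · simp [hj]
      have e2 : ∀ j, (Function.update z i (t, c) j).2 = Function.update (fun j => (z j).2) i c j :=
        fun j => by
          rcases eq_or_ne j i with rfl | hj
          · simp
          · simp [hj]
      simp only [e1, e2]
    have hφ' : φ ∈ weightSpace L M (∑ j, (z j).1) := by
      rw [← wt_ofFn, ← hz]
      simpa [add_assoc] using hφ
    simp only [h6]
    refine ⟨fun a b => ?_, fun c a => ?_, fun a => ?_⟩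
    · simp only [f.1.map_update_add, ← evalHom_apply _ hφ', map_add]
    · simp only [f.1.map_update_smul, ← evalHom_apply _ hφ', map_smul]
    · have h7 := f.2.1 (Function.update (fun j => (z j).2) i a) i
      simp only [Function.update_self, Function.update_idem] at h7
      beta_reduce
      rw [h7, ← evalHom_apply _ hφ', map_neg, evalHom_apply, evalAt_specOp hφ', ← h5]
  skew xs ys x y φ hφ := by
    by_cases hn : (xs ++ x :: y :: ys).length = k + 1
    swap
    · rw [functional_hasArity _ _ hn, functional_hasArity _ _ (by simpa using hn)]
      simp
    obtain ⟨z, hz⟩ := eq_ofFn_of_length hn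
    have hlen : xs.length < k := by simp at hn; omega
    obtain ⟨xs', ys', h1, h2, h3⟩ := ofFn_swap z ⟨xs.length, hlen⟩
    rw [← hz] at h2
    obtain ⟨rfl, h4⟩ := List.append_inj h2 h1.symm
    obtain ⟨h5, h6⟩ := List.cons_eq_cons.1 h4
    obtain ⟨h7, rfl⟩ := List.cons_eq_cons.1 h6
    rw [← h5, ← h7] at h3
    have hφ' : φ ∈ weightSpace L M (∑ j, (z j).1) := by
      rwa [← wt_ofFn, ← hz]
    rw [hz, ← h3, pair_functional_ofFn, pair_functional_ofFn]
    generalize hσ : Equiv.swap (Fin.castSucc ⟨xs.length, hlen⟩) (Fin.succ ⟨xs.length, hlen⟩) = σ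
    have h8 := congrArg (evalAt (fun j => (z j).1) φ) (f.2.2 σ fun j => (z j).2)
    rw [evalAt_at hφ' _ _ (fun j => (z (σ j)).1) fun i P => evalAt_specOp hφ' _ _] at h8
    rw [h8, ← hσ, Equiv.Perm.sign_swap (Fin.castSucc_lt_succ).ne]
    rw [← evalHom_apply _ hφ' (_ • _), map_zsmul]
    simp

end

/-- A map with conformal functionals is a cochain: evaluate at the spectral operators. -/
lemma exists_cochain {N : ℕ} (f : PreCochain L N)
    (H : ∀ (R : Type u) [CommRing R] [Algebra ℂ R] [Module R (LPoly L N)]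
      [IsScalarTower ℂ R (LPoly L N)], IsConformal (R := R) (LPoly L N) (functional f)) :
    ∃ F : cochains L N, (⇑F.1 : PreCochain L N) = f := by
  obtain ⟨R, _, _, _, _, t, ht⟩ := exists_commRing_specOp L N
  have hF := H R
  have hg := const_mem_weightSpace ht
  have hslot : ∀ (p : Fin (N + 1) → L) (i : Fin (N + 1)),
      (fun c => f (Function.update p i c)) ∈ weightSpace L (LPoly L N) (t i) := by
    intro p i
    obtain ⟨xs, ys, h1, h2⟩ := ofFn_update (fun j => (t j, p j)) i
    have h3 : ∀ c : L, f (Function.update p i c)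
        = pair (functional f (xs ++ (t i, c) :: ys)) (const N) := fun c => by
      rw [← pair_functional_specOp ht f, ← h2]
      congr 4
      funext j
      rcases eq_or_ne j i with rfl | hj
      · simp
      · simp [hj]
    simp only [h3]
    refine hF.slot xs ys (t i) _ ?_
    have h4 := h2 (t i, p i)
    rw [Function.update_eq_self] at h4
    rw [← wt_ofFn (fun j => (t j, p j)), h4] at hg
    simpa [add_assoc] using hg
  refine ⟨⟨{ toFun := f, map_update_add' := ?_, map_update_smul' := ?_ }, ?_, ?_⟩, rfl⟩
  · intro inst p i x y
    rw [Subsingleton.elim inst (instDecidableEqFin (N + 1))]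
    exact (hslot p i).1 x y
  · intro inst p i c x
    rw [Subsingleton.elim inst (instDecidableEqFin (N + 1))]
    exact (hslot p i).2.1 c x
  · intro p i
    have := (hslot p i).2.2 (p i)
    beta_reduce at this
    rw [Function.update_eq_self, ht] at this
    exact this
  · intro σ p
    have h1 := hF.perm (fun j => (t j, p j)) (const N) hg σ
    rw [pair_functional_specOp ht f p, pair_functional_ofFn] at h1
    rw [MultilinearMap.coe_mk, ← h1, ← evalAt_const_self ht (PreCochain.at _ _ _)]
    refine evalAt_at hg f _ (fun i => t (σ i)) (fun i P => ?_) _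
    rw [evalAt_specOp hg]

end Cochain

/-! ### Unshuffles with a first part of length one or two -/

section SmallUnshuffle

variable {X V : Type*} [AddCommGroup V]

/-- Alternating sums over the choice of one element of a family. -/
lemma sum_succAbove_eq_unsh {n : ℕ} (x : Fin (n + 1) → X) (g : X → List X → V) :
    ∑ i : Fin (n + 1), (-1 : ℤ) ^ (i : ℕ) • g (x i) (List.ofFn fun j => x (i.succAbove j))
      = unsh (List.ofFn x) fun A B => match A with
        | [y] => g y B
        | _ => 0 := by
  induction n generalizing g with
  | zero => simp [unsh_cons]
  | succ n ih =>
    rw [Fin.sum_univ_succ, List.ofFn_succ (f := x), unsh_cons, unsh_of_left_nil]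
    · congr 1
      · simp
      · have h := ih (fun i => x i.succ) fun y B => -g y (x 0 :: B)
        refine Eq.trans (Finset.sum_congr rfl fun i _ => ?_) (h.trans (unsh_congr fun A B _ => ?_))
        · simp [List.ofFn_succ, pow_succ]
        · rcases A with _ | ⟨a, _ | ⟨b, A⟩⟩ <;> simp
    · rintro (_ | ⟨a, A⟩) B hA
      · exact absurd rfl hA
      · rfl

/-- Alternating sums over the choice of two elements of a family. -/
lemma sum_succAbove_succAbove_eq_unsh {n : ℕ} (x : Fin (n + 2) → X) (g : X → X → List X → V) :
    (∑ j : Fin (n + 2), ∑ i : Fin (n + 1), if i.castSucc < j then (-1 : ℤ) ^ ((i : ℕ) + (j : ℕ)) •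
        g (x i.castSucc) (x j) (List.ofFn fun m => x (j.succAbove (i.succAbove m))) else 0)
      = - unsh (List.ofFn x) fun A B => match A with
        | [y, z] => g y z B
        | _ => 0 := by
  induction n generalizing g with
  | zero => simp [unsh_cons, Fin.sum_univ_succ, List.ofFn_succ]
  | succ n ih =>
    have h1 := sum_succAbove_eq_unsh (fun i => x i.succ) (g (x 0))
    have h2 := ih (fun i => x i.succ) fun y z B => g y z (x 0 :: B)
    rw [Fin.sum_univ_succ]
    simp only [Fin.not_lt_zero, if_false, Finset.sum_const_zero, zero_add]
    refine Eq.trans (Finset.sum_congr rfl fun j _ => Fin.sum_univ_succ _) ?_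
    rw [Finset.sum_add_distrib, List.ofFn_succ (f := x), unsh_cons, neg_add]
    congr 1
    · rw [← unsh_neg]
      have h3 : ∀ A B, (match x 0 :: A with
        | [y, z] => g y z B
        | _ => 0) = (match A with
        | [z] => g (x 0) z B
        | _ => 0) := by
        rintro (_ | ⟨a, _ | ⟨b, A⟩⟩) B <;> rfl
      simp only [h3]
      rw [unsh_neg, ← h1, ← Finset.sum_neg_distrib]
      refine Finset.sum_congr rfl fun j _ => ?_
      simp [pow_succ]
    · refine Eq.trans (Finset.sum_congr rfl fun j _ => Finset.sum_congr rfl fun i _ => ?_)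
        (h2.trans (congrArg Neg.neg (unsh_congr fun A B _ => ?_)))
      · simp only [← Fin.succ_castSucc, Fin.succ_lt_succ_iff, List.ofFn_succ (n := n)]
        simp [pow_add]
      · rcases A with _ | ⟨a, _ | ⟨b, _ | ⟨c, A⟩⟩⟩ <;> simp

end SmallUnshuffle

/-! ### The functionals of insertions, cup products and coboundaries -/

section Operations

variable {L : Type u} [AddCommGroup L] [Module ℂ L] [Module (Polynomial ℂ) L]
  [IsScalarTower ℂ (Polynomial ℂ) L]
  {R M : Type*} [CommRing R] [Algebra ℂ R]
  [AddCommGroup M] [Module ℂ M] [Module R M] [IsScalarTower ℂ R M]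

/-- Insertion of cochains is composition of functionals. -/
lemma functional_insertion {k l N : ℕ} (h : k + l = N) (J : PreCochain L k)
    (K : PreCochain L l) :
    Eqv (R := R) M (functional (insertion h J K)) (comp (functional J) (functional K)) := by
  intro xs φ hφ
  rw [pair_comp]
  by_cases hn : xs.length = N + 1
  swap
  · rw [functional_hasArity _ _ hn, map_zero, LinearMap.zero_apply, ← unsh_zero xs]
    refine unsh_congr fun A B hp => ?_
    have hl := hp.length_eq
    rw [List.length_append] at hl
    by_cases hA : A.length = l + 1
    · have hB : ∀ c : L, functional (R := R) J ((wt A, c) :: B) = 0 := fun c =>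
        functional_hasArity _ _ (by simp; omega)
      simp [hB]
    · rw [functional_hasArity _ _ hA, map_zero, LinearMap.zero_apply]
  obtain ⟨x, rfl⟩ := eq_ofFn_of_length hn
  rw [wt_ofFn] at hφ
  have h' : (l + 1) + k = N + 1 := by omega
  have h0 : (unsh (List.ofFn x) fun A B => pair (functional K A) fun c =>
      pair (functional J ((wt A, c) :: B)) φ) = unsh (List.ofFn x) fun A B =>
        if A.length = l + 1 then pair (functional K A) fun c =>
          pair (functional J ((wt A, c) :: B)) φ else 0 := by
    refine unsh_congr fun A B _ => ?_
    split_ifs with hA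
    · rfl
    · rw [functional_hasArity _ _ hA, map_zero, LinearMap.zero_apply]
  rw [h0, ← sum_shuffles h', pair_functional_ofFn, insertion, ← evalHom_apply _ hφ, map_sum]
  refine Finset.sum_congr rfl fun τ _ => ?_
  rw [map_zsmul, evalHom_apply, evalAt_subst hφ _ (fun i => (x (τ (fstBlock h' i))).1)
    fun i P => evalAt_specOp hφ _ _, pair_functional_ofFn]
  congr 2
  funext c
  rw [pair_functional_cons_ofFn, wt_ofFn, evalAt_at hφ]
  intro i P
  cases i using Fin.cases with
  | zero =>
    simp only [Fin.cons_zero]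
    exact evalAt_sum_specOp _ _ hφ P
  | succ j => exact evalAt_specOp hφ _ P

/-- The `λ`-bracket as a map `L² → L[λ]`. -/
def LieConformalAlgebra.bracketMap (A : LieConformalAlgebra L) : PreCochain L 1 :=
  fun p => A.bracket (p 0) (p 1)

variable (A : LieConformalAlgebra L)

lemma pair_bracketMap {R M : Type*} [CommRing R] [AddCommGroup M] [Module R M] (y z : R × L)
    (φ : L → M) :
    pair (functional A.bracketMap [y, z]) φ = evalAt ![y.1, z.1] φ (A.bracket y.2 z.2) :=
  pair_functional_two A.bracketMap y z φ

lemma evalAt_bracketAt {k : ℕ} {t : Fin (k + 1) → R} {φ : L → M}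
    (h : φ ∈ weightSpace L M (∑ i, t i)) (T : Module.End ℂ (LPoly L k)) (y z : R × L)
    (hT : ∀ P, evalAt t φ (T P) = y.1 • evalAt t φ P) :
    evalAt t φ (A.bracketAt T y.2 z.2) = pair (functional A.bracketMap [y, z]) φ := by
  rw [LieConformalAlgebra.bracketAt, pair_bracketMap, evalAt_subst h _ ![y.1, z.1]]
  · simp only [evalAt_const h]
  · intro i P
    obtain rfl : i = 0 := Fin.fin_one_eq_zero i
    exact hT P

lemma functional_cup {k l : ℕ} (J : PreCochain L k) (K : PreCochain L l) (xs : List (R × L))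
    (φ : L → M) (hφ : φ ∈ weightSpace L M (wt xs)) :
    pair (functional (A.cup J K) xs) φ = unsh xs fun B C => pair (functional J B) fun b =>
      pair (functional K C) fun c =>
        pair (functional A.bracketMap [(wt B, b), (wt C, c)]) φ := by
  by_cases hn : xs.length = k + l + 1 + 1
  swap
  · rw [functional_hasArity _ _ hn, map_zero, LinearMap.zero_apply, ← unsh_zero xs]
    refine unsh_congr fun B C hp => ?_
    have hl := hp.length_eq
    rw [List.length_append] at hl
    by_cases hB : B.length = k + 1
    · simp [functional_hasArity K C (by omega)]
    · rw [functional_hasArity _ _ hB, map_zero, LinearMap.zero_apply]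
  obtain ⟨x, rfl⟩ := eq_ofFn_of_length hn
  rw [wt_ofFn] at hφ
  have h' : (k + 1) + (l + 1) = k + l + 1 + 1 := by omega
  have h0 : (unsh (List.ofFn x) fun B C => pair (functional J B) fun b =>
      pair (functional K C) fun c => pair (functional A.bracketMap [(wt B, b), (wt C, c)]) φ)
      = unsh (List.ofFn x) fun B C => if B.length = k + 1 then pair (functional J B) fun b =>
      pair (functional K C) fun c => pair (functional A.bracketMap [(wt B, b), (wt C, c)]) φ
        else 0 := by
    refine unsh_congr fun B C _ => ?_
    split_ifs with hB
    · rfl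
    · rw [functional_hasArity _ _ hB, map_zero, LinearMap.zero_apply]
  rw [h0, ← sum_shuffles h', pair_functional_ofFn, LieConformalAlgebra.cup, ← evalHom_apply _ hφ,
    map_sum]
  refine Finset.sum_congr rfl fun τ _ => ?_
  rw [map_zsmul, evalHom_apply, evalAt_subst hφ _ (fun i => (x (τ (fstBlock h' i))).1)
    fun i P => evalAt_specOp hφ _ _, pair_functional_ofFn]
  congr 2
  funext b
  rw [evalAt_subst hφ _ (fun i => (x (τ (sndBlock h' i))).1)
    fun i P => evalAt_specOp hφ _ _, pair_functional_ofFn]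
  congr 1
  funext c
  refine evalAt_bracketAt A hφ _ (_, b) (_, c) fun P => ?_
  rw [wt_ofFn]
  exact evalAt_sum_specOp _ _ hφ P

/-- The coboundary is the graded commutator with the `λ`-bracket. Skew-symmetry of the bracket is
needed because the coboundary has `[p_i, f(…)]` where the composition has `[f(…), p_i]`. -/
lemma functional_coboundary {k : ℕ} (f : PreCochain L k) (xs : List (R × L))
    (φ : L → M) (hφ : φ ∈ weightSpace L M (wt xs))
    (hskew : ∀ y z : R × L, φ ∈ weightSpace L M (wt [y, z]) →
      pair (functional A.bracketMap [y, z]) φ = - pair (functional A.bracketMap [z, y]) φ) :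
    pair (functional (A.coboundary f) xs) φ
      = (-1 : ℤ) ^ k • pair (comp (functional A.bracketMap) (functional f) xs) φ
        - pair (comp (functional f) (functional A.bracketMap) xs) φ := by
  rw [pair_comp, pair_comp, ← unsh_zsmul]
  by_cases hn : xs.length = k + 1 + 1
  swap
  · rw [functional_hasArity _ _ hn, map_zero, LinearMap.zero_apply, sub_eq_add_neg, ← unsh_neg,
      ← unsh_add, ← unsh_zero xs]
    refine unsh_congr fun B C hp => ?_
    have hl := hp.length_eq
    rw [List.length_append] at hl
    have h1 : (pair (functional f B) fun c =>
        pair (functional A.bracketMap ((wt B, c) :: C)) φ) = 0 := by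
      by_cases hB : B.length = k + 1
      · have hC : ∀ c : L, functional (R := R) A.bracketMap ((wt B, c) :: C) = 0 := fun c =>
          functional_hasArity _ _ (by simp; omega)
        simp [hC]
      · rw [functional_hasArity _ _ hB, map_zero, LinearMap.zero_apply]
    have h2 : (pair (functional A.bracketMap B) fun c =>
        pair (functional f ((wt B, c) :: C)) φ) = 0 := by
      by_cases hB : B.length = 1 + 1
      · have hC : ∀ c : L, functional (R := R) f ((wt B, c) :: C) = 0 := fun c =>
          functional_hasArity _ _ (by simp; omega)
        simp [hC]
      · rw [functional_hasArity _ _ hB, map_zero, LinearMap.zero_apply]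
    rw [h1, h2]
    simp
  obtain ⟨x, rfl⟩ := eq_ofFn_of_length hn
  rw [pair_functional_ofFn, LieConformalAlgebra.coboundary]
  have hφ' := hφ
  rw [wt_ofFn] at hφ'
  rw [← evalHom_apply _ hφ', map_add, sub_eq_add_neg, map_sum, map_sum]
  congr 1
  · have h1 := sum_succAbove_eq_unsh x fun y B => pair (functional f B) fun c =>
      pair (functional A.bracketMap [y, (wt B, c)]) φ
    refine (Finset.sum_congr rfl fun i _ => ?_).trans (h1.trans ?_)
    · rw [map_zsmul, evalHom_apply, evalAt_subst hφ' _ (fun j => (x (i.succAbove j)).1)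
        fun i P => evalAt_specOp hφ' _ _, pair_functional_ofFn]
      congr 2
      funext c
      exact evalAt_bracketAt A hφ' _ (x i) (_, c) fun P => evalAt_specOp hφ' _ _
    · rw [unsh_comm _ fun B C => (-1 : ℤ) ^ k • _]
      refine unsh_congr fun B C hp => ?_
      rcases B with _ | ⟨y, _ | ⟨z, B⟩⟩
      · have hC : ∀ c : L, functional (R := R) A.bracketMap [(wt C, c)] = 0 := fun c =>
          functional_hasArity _ _ (by simp)
        simp [hC]
      · by_cases hC : C.length = k + 1
        · rw [smul_smul, ← pair_zsmul]
          simp only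
          congr 1
          funext c
          rw [hskew]
          · rcases neg_one_pow_eq_or ℤ k with hk | hk <;> simp [hC, pow_succ, hk]
          · convert hφ using 2
            rw [← wt_perm hp]
            simp
        · simp [functional_hasArity f C hC]
      · have hC : ∀ c : L, functional (R := R) A.bracketMap ((wt C, c) :: y :: z :: B) = 0 :=
          fun c => functional_hasArity _ _ (by simp)
        simp [hC]
  · have h1 := sum_succAbove_succAbove_eq_unsh x fun y z B => pair (functional A.bracketMap [y, z])
      fun c => pair (functional f ((y.1 + z.1, c) :: B)) φ
    refine (Finset.sum_congr rfl fun j _ => ?_).trans (h1.trans ?_)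
    · rw [map_sum]
      refine Finset.sum_congr rfl fun i _ => ?_
      split_ifs with hij
      · rw [map_zsmul, evalHom_apply, evalAt_subst hφ' _ ![(x i.castSucc).1, (x j).1],
          pair_bracketMap]
        · congr 2
          funext c
          rw [pair_functional_cons_ofFn, evalAt_at hφ']
          intro m P
          cases m using Fin.cases with
          | zero =>
            simp only [Fin.cons_zero, LinearMap.add_apply]
            rw [← evalHom_apply _ hφ', map_add, evalHom_apply, evalHom_apply,
              evalAt_specOp hφ', evalAt_specOp hφ', add_smul]
          | succ m => exact evalAt_specOp hφ' _ P
        · intro m P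
          obtain rfl : m = 0 := Fin.fin_one_eq_zero m
          exact evalAt_specOp hφ' _ P
      · exact map_zero _
    · congr 1
      refine unsh_congr fun B C _ => ?_
      by_cases hB : B.length = 1 + 1
      · obtain ⟨y, z, rfl⟩ := List.length_eq_two.1 hB
        simp
      · rw [functional_hasArity _ _ hB]
        rcases B with _ | ⟨y, _ | ⟨z, _ | ⟨w, B⟩⟩⟩ <;> simp at hB ⊢

end Operations

/-! ### The pre-Lie algebra of cochains -/

section

variable {L : Type u} [AddCommGroup L] [Module ℂ L] [Module (Polynomial ℂ) L]
  [IsScalarTower ℂ (Polynomial ℂ) L]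

lemma neg_one_pow_zsmul {V : Type*} [AddCommGroup V] [Module ℂ V] (n : ℕ) (v : V) :
    (-1 : ℤ) ^ n • v = (-1 : ℂ) ^ n • v := by
  rcases Nat.even_or_odd n with h | h <;> simp [h.neg_one_pow]

section Value

variable {R M : Type*} [CommRing R] [Algebra ℂ R]
  [AddCommGroup M] [Module ℂ M] [Module R M] [IsScalarTower ℂ R M]

/-- The value of a cochain at a list of weighted points, as a linear function of the cochain. -/
def value {N : ℕ} (xs : List (R × L)) (φ : L → M) (hφ : φ ∈ weightSpace L M (wt xs)) :
    cochains L N →ₗ[ℂ] M where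
  toFun f := pair (functional f.1 xs) φ
  map_add' f g := by
    by_cases h : xs.length = N + 1
    · obtain ⟨x, rfl⟩ := eq_ofFn_of_length h
      simp only [pair_functional_ofFn, ← evalHom_apply _ hφ, ← map_add]
      rfl
    · simp [functional_hasArity _ _ h]
  map_smul' z f := by
    by_cases h : xs.length = N + 1
    · obtain ⟨x, rfl⟩ := eq_ofFn_of_length h
      simp only [pair_functional_ofFn, ← evalHom_apply _ hφ, ← map_smul]
      rfl
    · simp [functional_hasArity _ _ h]

lemma value_apply {N : ℕ} (xs : List (R × L)) (φ : L → M) (hφ : φ ∈ weightSpace L M (wt xs))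
    (f : cochains L N) : value xs φ hφ f = pair (functional f.1 xs) φ := rfl

lemma value_sub {N : ℕ} (xs : List (R × L)) (φ : L → M) (hφ : φ ∈ weightSpace L M (wt xs))
    (f g : cochains L N) : value xs φ hφ (f - g) = value xs φ hφ f - value xs φ hφ g := by
  simp only [value_apply]
  by_cases h : xs.length = N + 1
  · obtain ⟨x, rfl⟩ := eq_ofFn_of_length h
    simp only [pair_functional_ofFn, ← evalHom_apply _ hφ, ← map_sub]
    rfl
  · simp [functional_hasArity _ _ h]

end Value

lemma cochain_ext {N : ℕ} {f g : cochains L N}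
    (H : ∀ (R : Type u) [CommRing R] [Algebra ℂ R] [Module R (LPoly L N)]
      [IsScalarTower ℂ R (LPoly L N)] (xs : List (R × L)) (φ : L → LPoly L N)
      (hφ : φ ∈ weightSpace L (LPoly L N) (wt xs)), value xs φ hφ f = value xs φ hφ g) : f = g :=
  Subtype.ext (DFunLike.coe_injective
    (PreCochain.ext_functional fun R _ _ _ _ xs φ hφ => H R xs φ hφ))

lemma exists_insertion {k l N : ℕ} (h : k + l = N) (J : cochains L k) (K : cochains L l) :
    ∃ F : cochains L N, (⇑F.1 : PreCochain L N) = insertion h J.1 K.1 :=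
  exists_cochain _ fun _ => ((functional_isConformal J).comp (functional_isConformal K)).congr
    (functional_insertion h _ _)

/-- The insertion of a cochain in a cochain, as a cochain. -/
def ins {k l N : ℕ} (h : k + l = N) (J : cochains L k) (K : cochains L l) : cochains L N :=
  (exists_insertion h J K).choose

lemma coe_ins {k l N : ℕ} (h : k + l = N) (J : cochains L k) (K : cochains L l) :
    (⇑(ins h J K).1 : PreCochain L N) = insertion h J.1 K.1 :=
  (exists_insertion h J K).choose_spec

section

variable {R M : Type*} [CommRing R] [Algebra ℂ R]
  [AddCommGroup M] [Module ℂ M] [Module R M] [IsScalarTower ℂ R M]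

lemma functional_ins {k l N : ℕ} (h : k + l = N) (J : cochains L k) (K : cochains L l) :
    Eqv (R := R) M (functional (ins h J K).1) (comp (functional J.1) (functional K.1)) := by
  rw [coe_ins]
  exact functional_insertion h _ _

lemma value_ins {k l N : ℕ} (h : k + l = N) (J : cochains L k) (K : cochains L l)
    (xs : List (R × L)) (φ : L → M) (hφ : φ ∈ weightSpace L M (wt xs)) :
    value xs φ hφ (ins h J K) = unsh xs fun A B =>
      pair (functional K.1 A) fun c => pair (functional J.1 ((wt A, c) :: B)) φ :=
  (functional_ins h J K xs φ hφ).trans (pair_comp _ _ _ _)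

end

/-- The insertion as a bilinear map. -/
def insLin {k l N : ℕ} (h : k + l = N) : cochains L k →ₗ[ℂ] cochains L l →ₗ[ℂ] cochains L N :=
  LinearMap.mk₂ ℂ (ins h)
    (fun J J' K => cochain_ext fun R _ _ _ _ xs φ hφ => by
      rw [map_add, value_ins, value_ins, value_ins, ← unsh_add]
      refine unsh_congr fun A B hp => ?_
      rw [← pair_add]
      congr 1
      funext c
      have hφ' : φ ∈ weightSpace L _ (wt ((wt A, c) :: B)) := by
        rwa [wt_cons, ← wt_append, wt_perm hp]
      exact map_add (value _ φ hφ') J J')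
    (fun z J K => cochain_ext fun R _ _ _ _ xs φ hφ => by
      rw [map_smul, value_ins, value_ins]
      refine Eq.trans (unsh_congr fun A B hp => ?_)
        (map_unsh (DistribSMul.toAddMonoidHom _ z) xs _).symm
      rw [DistribSMul.toAddMonoidHom_apply, ← algebraMap_smul R z (pair _ _), ← map_smul]
      congr 1
      funext c
      have hφ' : φ ∈ weightSpace L _ (wt ((wt A, c) :: B)) := by
        rwa [wt_cons, ← wt_append, wt_perm hp]
      rw [Pi.smul_apply, algebraMap_smul]
      exact map_smul (value _ φ hφ') z J)
    (fun J K K' => cochain_ext fun R _ _ _ _ xs φ hφ => by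
      rw [map_add, value_ins, value_ins, value_ins, ← unsh_add]
      refine unsh_congr fun A B hp => ?_
      exact map_add (value A _ ((functional_isConformal J).slot_head hp hφ rfl)) K K')
    (fun z J K => cochain_ext fun R _ _ _ _ xs φ hφ => by
      rw [map_smul, value_ins, value_ins]
      refine Eq.trans (unsh_congr fun A B hp => ?_)
        (map_unsh (DistribSMul.toAddMonoidHom _ z) xs _).symm
      exact map_smul (value A _ ((functional_isConformal J).slot_head hp hφ rfl)) z K)

section

variable {R M : Type*} [CommRing R] [Algebra ℂ R]
  [AddCommGroup M] [Module ℂ M] [Module R M] [IsScalarTower ℂ R M]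

/-- The associator of the insertion product consists of the simultaneous insertions. -/
lemma value_assoc {i j k a b N : ℕ} (h₁ : i + j = a) (h₂ : a + k = N) (h₃ : j + k = b)
    (h₄ : i + b = N) (J : cochains L i) (K : cochains L j) (P : cochains L k)
    {G H : Functional R L} (hG : Eqv M (functional K.1) G) (hH : Eqv M (functional P.1) H)
    (xs : List (R × L)) (φ : L → M) (hφ : φ ∈ weightSpace L M (wt xs)) :
    value xs φ hφ (ins h₂ (ins h₁ J K) P - ins h₄ J (ins h₃ K P))
      = pair (brace (functional J.1) G H xs) φ := by
  have cJ := functional_isConformal (R := R) (M := M) J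
  have cG : IsConformal M G := (functional_isConformal K).congr hG.symm
  have e1 : Eqv M (functional (ins h₂ (ins h₁ J K) P).1) (comp (comp (functional J.1) G) H) :=
    (functional_ins h₂ _ _).trans (Eqv.comp
      ((functional_ins h₁ _ _).trans (Eqv.comp (fun _ _ _ => rfl) hG cJ)) hH (cJ.comp cG))
  have e2 : Eqv M (functional (ins h₄ J (ins h₃ K P)).1) (comp (functional J.1) (comp G H)) :=
    (functional_ins h₄ _ _).trans (Eqv.comp (fun _ _ _ => rfl)
      ((functional_ins h₃ _ _).trans (Eqv.comp hG hH cG)) cJ)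
  rw [value_sub, value_apply, value_apply, e1 xs φ hφ, e2 xs φ hφ, comp_comp, map_add,
    LinearMap.add_apply, add_sub_cancel_left]

end

/-- The graded right pre-Lie identity of the insertion product. -/
lemma ins_right_symm {i j k a b c N : ℕ} (h₁ : i + j = a) (h₂ : a + k = N) (h₃ : j + k = b)
    (h₄ : i + b = N) (h₅ : i + k = c) (h₆ : c + j = N) (h₇ : k + j = b)
    (J : cochains L i) (K : cochains L j) (P : cochains L k) :
    ins h₂ (ins h₁ J K) P - ins h₄ J (ins h₃ K P)
      = (-1 : ℂ) ^ (j * k) • (ins h₆ (ins h₅ J P) K - ins h₄ J (ins h₇ P K)) := by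
  refine cochain_ext fun R _ _ _ _ xs φ hφ => ?_
  rw [map_smul, value_assoc h₁ h₂ h₃ h₄ J K P (fun _ _ _ => rfl) (fun _ _ _ => rfl),
    value_assoc h₅ h₆ h₇ h₄ J P K (fun _ _ _ => rfl) (fun _ _ _ => rfl), ← neg_one_pow_zsmul]
  exact brace_symm (functional_isConformal J) (functional_hasArity _) (functional_hasArity _)
    xs φ hφ

/-- The associator of `Q`, `J`, `K` is the simultaneous insertion of `J` and `K` in `Q`. If `Q` has
two arguments, a further insertion of `P` takes place in `J` or in `K`. -/
lemma ins_quadratic {i j k a b c d e f g N : ℕ} (Q : cochains L 1) (J : cochains L i)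
    (K : cochains L j) (P : cochains L k)
    (h₁ : 1 + i = a) (h₂ : a + j = b) (h₃ : i + j = c) (h₄ : 1 + c = b) (h₅ : b + k = N)
    (h₆ : j + k = d) (h₇ : a + d = N) (h₈ : i + d = e) (h₉ : 1 + e = N)
    (h₁₀ : i + k = f) (h₁₁ : 1 + f = g) (h₁₂ : g + j = N) (h₁₃ : f + j = e) :
    ins h₅ (ins h₂ (ins h₁ Q J) K - ins h₄ Q (ins h₃ J K)) P
      = (ins h₇ (ins h₁ Q J) (ins h₆ K P) - ins h₉ Q (ins h₈ J (ins h₆ K P)))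
        + (-1 : ℂ) ^ (k * j) • (ins h₁₂ (ins h₁₁ Q (ins h₁₀ J P)) K
          - ins h₉ Q (ins h₁₃ (ins h₁₀ J P) K)) := by
  refine cochain_ext fun R _ _ _ _ xs φ hφ => ?_
  have e1 : Eqv (R := R) (LPoly L N)
      (functional (ins h₂ (ins h₁ Q J) K - ins h₄ Q (ins h₃ J K)).1)
      (brace (functional Q.1) (functional J.1) (functional K.1)) := fun xs φ hφ =>
    value_assoc h₁ h₂ h₃ h₄ Q J K (fun _ _ _ => rfl) (fun _ _ _ => rfl) xs φ hφ
  have e2 := (functional_ins (R := R) (M := LPoly L N) h₅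
    (ins h₂ (ins h₁ Q J) K - ins h₄ Q (ins h₃ J K)) P).trans
    (Eqv.comp e1 (fun _ _ _ => rfl) ((functional_isConformal _).congr e1.symm))
  rw [map_add, map_smul, value_apply, e2 xs φ hφ,
    value_assoc h₁ h₇ h₈ h₉ Q J _ (fun _ _ _ => rfl) (functional_ins h₆ K P),
    value_assoc h₁₁ h₁₂ h₁₃ h₉ Q _ K (functional_ins h₁₀ J P) (fun _ _ _ => rfl),
    brace_comp (functional_hasArity _) (functional_hasArity _) (functional_hasArity _), map_add,
    LinearMap.add_apply, pair_zsmul_left, neg_one_pow_zsmul]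

/-! ### The `λ`-bracket as a cochain -/

/-- Substituting the spectral operators for the parameters changes nothing. -/
lemma at_specOp {N : ℕ} (f : PreCochain L N) (p : Fin (N + 1) → L) :
    f.at (fun i => specOp i) p = f p := by
  obtain ⟨R, _, _, _, _, t, ht⟩ := exists_commRing_specOp L N
  have hg := const_mem_weightSpace ht
  rw [← evalAt_const_self ht (f.at _ p), evalAt_at hg f _ t fun i P => evalAt_specOp hg i P,
    evalAt_const_self ht]

namespace LieConformalAlgebra

variable (A : LieConformalAlgebra L)

/-- The `λ`-bracket as an element of `C²(L, L)`. -/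
def bracketCochain : cochains L 1 :=
  ⟨{  toFun := A.bracketMap
      map_update_add' := by
        intro inst p i x y
        rw [Subsingleton.elim inst (instDecidableEqFin 2)]
        fin_cases i <;> simp [bracketMap]
      map_update_smul' := by
        intro inst p i c x
        rw [Subsingleton.elim inst (instDecidableEqFin 2)]
        fin_cases i <;> simp [bracketMap] }, by
    constructor
    · intro p i
      cases i using Fin.lastCases with
      | cast i =>
        obtain rfl : i = 0 := Fin.fin_one_eq_zero i
        rw [specOp, Fin.lastCases_castSucc]
        simpa [bracketMap] using A.sesq_left (p 0) (p 1)
      | last =>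
        simp only [specOp, Fin.lastCases_last]
        simpa [bracketMap, lamDagger, add_comm] using A.sesq_right (p 0) (p 1)
    · intro σ p
      obtain rfl | rfl : σ = 1 ∨ σ = Equiv.swap 0 1 := by revert σ; decide
      · simpa using at_specOp A.bracketMap p
      · have h := A.skew (p 0) (p 1)
        have h2 : ∀ i : Fin 1, (specOp (Equiv.swap 0 1 i.castSucc) : Module.End ℂ (LPoly L 1))
            = lamDagger 1 := fun i => by
          obtain rfl : i = 0 := Fin.fin_one_eq_zero i
          exact Fin.lastCases_last
        simp only [MultilinearMap.coe_mk, PreCochain.at, h2]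
        simp only [bracketMap, Equiv.swap_apply_left, Equiv.swap_apply_right]
        rw [h]
        simp⟩

lemma coe_bracketCochain : (⇑A.bracketCochain.1 : PreCochain L 1) = A.bracketMap := rfl

/-- The Jacobi identity of the `λ`-bracket, as the vanishing of its insertion in itself. -/
lemma ins_bracketCochain : ins (N := 2) rfl A.bracketCochain A.bracketCochain = 0 := by
  refine cochain_ext fun R _ _ _ _ xs φ hφ => ?_
  rw [map_zero, value_ins]
  have hF : HasArity (functional (R := R) A.bracketCochain.1) 2 := functional_hasArity _
  by_cases hn : xs.length = 3
  swap
  · rw [← unsh_zero xs]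
    refine unsh_congr fun B C hp => ?_
    have hl := hp.length_eq
    rw [List.length_append] at hl
    by_cases hB : B.length = 2
    · have hC : ∀ c : L, functional (R := R) A.bracketCochain.1 ((wt B, c) :: C) = 0 := fun c =>
        hF _ (by simp; omega)
      simp [hC]
    · rw [hF _ hB, map_zero, LinearMap.zero_apply]
  -- the Jacobi identity is evaluated at the weights of three points, and skew-symmetry brings the
  -- inner brackets to the first argument
  obtain ⟨x, y, z, rfl⟩ := List.length_eq_three.1 hn
  have h0 : functional (R := R) A.bracketCochain.1 [] = 0 := hF _ (by simp)
  have h1 : ∀ a, functional (R := R) A.bracketCochain.1 [a] = 0 := fun a => hF _ (by simp)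
  have h3 : ∀ a b c, functional (R := R) A.bracketCochain.1 [a, b, c] = 0 :=
    fun a b c => hF _ (by simp)
  have hφ' : φ ∈ weightSpace L _ (∑ i, (![x.1, y.1, z.1] : Fin 3 → R) i) := by
    simpa [Fin.sum_univ_succ, add_assoc] using hφ
  have hskew := (functional_isConformal (R := R) (M := LPoly L 2) A.bracketCochain).skew [] []
  have e1 : ∀ c, pair (functional (R := R) A.bracketCochain.1 [x, (y.1 + z.1, c)]) φ
      = - pair (functional A.bracketCochain.1 [(y.1 + z.1, c), x]) φ := fun c =>
    hskew _ _ φ (by simpa using hφ)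
  have e2 : ∀ c, pair (functional (R := R) A.bracketCochain.1 [y, (x.1 + z.1, c)]) φ
      = - pair (functional A.bracketCochain.1 [(x.1 + z.1, c), y]) φ := fun c =>
    hskew _ _ φ (by simpa [add_left_comm] using hφ)
  have hl : ∀ (i : Fin 2) (P : LPoly L 2), evalAt ![x.1, y.1, z.1] φ (lam i P)
      = (![x.1, y.1, z.1] : Fin 3 → R) i.castSucc • evalAt ![x.1, y.1, z.1] φ P :=
    fun i P => evalAt_lam hφ' i P
  have hjac := congrArg (evalHom ![x.1, y.1, z.1] hφ') (A.jacobi x.2 y.2 z.2)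
  rw [map_add, evalHom_apply, evalHom_apply, evalHom_apply,
    evalAt_subst hφ' _ ![y.1, z.1] (fun i P => ?_),
    evalAt_subst hφ' _ ![x.1, y.1] (fun i P => ?_),
    evalAt_subst hφ' _ ![x.1, z.1] (fun i P => ?_)] at hjac
  · have j1 : ∀ c, evalAt ![x.1, y.1, z.1] φ
        (subst (fun _ => lam 0) (const 2) (A.bracket x.2 c) : LPoly L 2)
        = pair (functional A.bracketMap [x, (y.1 + z.1, c)]) φ := fun c =>
      evalAt_bracketAt A hφ' (lam 0) x (y.1 + z.1, c) fun P => hl 0 P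
    have j2 : ∀ c, evalAt ![x.1, y.1, z.1] φ
        (subst (fun _ => lam 0 + lam 1) (const 2) (A.bracket c z.2) : LPoly L 2)
        = pair (functional A.bracketMap [(x.1 + y.1, c), z]) φ := fun c =>
      evalAt_bracketAt A hφ' (lam 0 + lam 1) (x.1 + y.1, c) z fun P => by
        rw [LinearMap.add_apply, ← evalHom_apply _ hφ', map_add, add_smul]
        exact congrArg₂ _ (hl 0 P) (hl 1 P)
    have j3 : ∀ c, evalAt ![x.1, y.1, z.1] φ
        (subst (fun _ => lam 1) (const 2) (A.bracket y.2 c) : LPoly L 2)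
        = pair (functional A.bracketMap [y, (x.1 + z.1, c)]) φ := fun c =>
      evalAt_bracketAt A hφ' (lam 1) y (x.1 + z.1, c) fun P => hl 1 P
    simp only [j1, j2, j3, ← pair_bracketMap] at hjac
    simp only [coe_bracketCochain] at h0 h1 h3 e1 e2 ⊢
    simp only [e1, e2, pair_neg] at hjac
    simp only [unsh_cons, unsh_nil, h0, h1, h3, map_zero, LinearMap.zero_apply, wt_cons, wt_nil,
      add_zero]
    simp
    rw [← hjac]
    exact neg_add_cancel _
  · obtain rfl : i = 0 := Fin.fin_one_eq_zero i
    exact hl 0 P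
  · obtain rfl : i = 0 := Fin.fin_one_eq_zero i
    exact hl 0 P
  · obtain rfl : i = 0 := Fin.fin_one_eq_zero i
    exact hl 1 P

/-- The coboundary of a cochain, as a cochain: its graded commutator with the `λ`-bracket. -/
def diffCochain {k : ℕ} (J : cochains L k) : cochains L (k + 1) :=
  (-1 : ℂ) ^ k • ins (add_comm 1 k) A.bracketCochain J - ins rfl J A.bracketCochain

lemma coe_diffCochain {k : ℕ} (J : cochains L k) :
    (⇑(A.diffCochain J).1 : PreCochain L (k + 1)) = A.coboundary J.1 := by
  refine PreCochain.ext_functional fun R _ _ _ _ xs φ hφ => ?_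
  rw [functional_coboundary A _ _ _ hφ, neg_one_pow_zsmul, ← value_apply xs φ hφ, diffCochain,
    value_sub, map_smul, value_apply, value_apply, functional_ins _ _ _ _ _ hφ,
    functional_ins _ _ _ _ _ hφ, coe_bracketCochain]
  intro y z hyz
  exact (functional_isConformal A.bracketCochain).skew [] [] y z φ hyz

/-- The cup product of two cochains, as a cochain: up to sign, their simultaneous insertion in the
`λ`-bracket. -/
def cupCochain {k l : ℕ} (J : cochains L k) (K : cochains L l) : cochains L (k + l + 1) :=
  (-1 : ℂ) ^ ((k + 1) * l) • (ins (add_right_comm k 1 l) (ins (add_comm 1 k) A.bracketCochain J) K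
      - ins (add_comm 1 (k + l)) A.bracketCochain (ins rfl J K))

lemma coe_cupCochain {k l : ℕ} (J : cochains L k) (K : cochains L l) :
    (⇑(A.cupCochain J K).1 : PreCochain L (k + l + 1)) = A.cup J.1 K.1 := by
  refine PreCochain.ext_functional fun R _ _ _ _ xs φ hφ => ?_
  rw [functional_cup A _ _ _ _ hφ, ← value_apply xs φ hφ, cupCochain, map_smul,
    value_assoc _ _ _ _ _ _ _ (fun _ _ _ => rfl) (fun _ _ _ => rfl), coe_bracketCochain,
    pair_brace, ← neg_one_pow_zsmul, ← unsh_zsmul,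
    unsh_comm _ fun B C => pair (functional (R := R) J.1 B) _]
  refine unsh_congr fun C B hp => ?_
  rw [unsh_of_right_nil]
  · by_cases hB : B.length = k + 1
    swap
    · simp [functional_hasArity _ _ hB]
    by_cases hC : C.length = l + 1
    swap
    · simp [functional_hasArity _ _ hC]
    rw [pair_comm, smul_smul, hB, hC]
    congr 1
    rcases neg_one_pow_eq_or ℤ k with hi | hi <;> rcases neg_one_pow_eq_or ℤ l with hj | hj <;>
      simp [pow_add, pow_mul, add_mul, mul_add, hi, hj]
  · intro A' C' hC'
    have hz : ∀ y z, functional (R := R) A.bracketMap (y :: z :: C') = 0 := fun y z =>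
      functional_hasArity _ _ (by simpa using hC')
    simp [hz]

/-- The Frölicher–Nijenhuis bracket of two cochains, as a cochain. -/
def fnCochain {k l : ℕ} (J : cochains L k) (K : cochains L l) : cochains L (k + l + 1) :=
  A.cupCochain J K + (-1 : ℂ) ^ (k + 1) • ins (by omega) K (A.diffCochain J)
    - (-1 : ℂ) ^ ((k + 1 + 1) * (l + 1)) • ins rfl J (A.diffCochain K)

lemma coe_fnCochain {k l : ℕ} (J : cochains L k) (K : cochains L l) :
    (⇑(A.fnCochain J K).1 : PreCochain L (k + l + 1)) = A.fnBracket J.1 K.1 := by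
  rw [fnBracket, ← coe_cupCochain, ← coe_diffCochain, ← coe_diffCochain, ← coe_ins, ← coe_ins,
    neg_one_pow_zsmul, neg_one_pow_zsmul]
  rfl

end LieConformalAlgebra

end

/-! ### The Frölicher–Nijenhuis bracket on the graded space of cochains -/

section

variable {L : Type u} [AddCommGroup L] [Module ℂ L] [Module (Polynomial ℂ) L]
  [IsScalarTower ℂ (Polynomial ℂ) L]

/-- Shifting the degrees of a direct sum by one gives a grading with zero part of degree `0`. -/
lemma isInternal_range_lof {M : ℕ → Type*} [∀ k, AddCommMonoid (M k)] [∀ k, Module ℂ (M k)]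
    {G : ℕ → Submodule ℂ (DirectSum ℕ M)} (h0 : G 0 = ⊥)
    (hG : ∀ k, G (k + 1) = LinearMap.range (DirectSum.lof ℂ ℕ M k)) : DirectSum.IsInternal G := by
  have hmem : ∀ k (a : M k), DirectSum.lof ℂ ℕ M k a ∈ G (k + 1) := fun k a =>
    (hG k).symm ▸ ⟨a, rfl⟩
  let dec : DirectSum ℕ M →ₗ[ℂ] DirectSum ℕ fun n => G n := DirectSum.toModule ℂ ℕ _ fun k =>
    (DirectSum.lof ℂ ℕ (fun n => G n) (k + 1)).comp
      ((DirectSum.lof ℂ ℕ M k).codRestrict (G (k + 1)) (hmem k))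
  have hdec : ∀ (k : ℕ) (a : M k), dec (DirectSum.lof ℂ ℕ M k a)
      = DirectSum.lof ℂ ℕ (fun n => G n) (k + 1) ⟨DirectSum.lof ℂ ℕ M k a, hmem k a⟩ := fun k a =>
    DirectSum.toModule_lof ℂ k a
  let _ := DirectSum.Decomposition.ofLinearMap G dec
    (DirectSum.linearMap_ext _ fun k => LinearMap.ext fun a => by
      rw [LinearMap.comp_apply, LinearMap.comp_apply, hdec, DirectSum.coeLinearMap_lof]
      rfl)
    (DirectSum.linearMap_ext _ fun n => LinearMap.ext fun x => by
      rw [LinearMap.comp_apply, LinearMap.comp_apply, DirectSum.coeLinearMap_lof]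
      obtain ⟨x, hx⟩ := x
      rcases n with _ | k
      · obtain rfl : x = 0 := by simpa [h0] using hx
        exact (map_zero dec).trans (map_zero _).symm
      · obtain ⟨a, rfl⟩ : x ∈ LinearMap.range (DirectSum.lof ℂ ℕ M k) := hG k ▸ hx
        exact hdec k a)
  exact DirectSum.Decomposition.isInternal _

/-- The subtraction on `C^*(L, L)`, defined by scalar multiplication with `-1`, so that the additive
monoid underlying the group is the one of the direct sum. -/
instance CStar.instAddCommGroup : AddCommGroup (CStar L) := Module.addCommMonoidToAddCommGroup ℂ

lemma ofDeg_sub {k : ℕ} (f g : cochains L k) : ofDeg k (f - g) = ofDeg k f - ofDeg k g :=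
  eq_sub_of_add_eq ((map_add _ _ _).symm.trans (congrArg (ofDeg k) (sub_add_cancel f g)))

/-- The bilinear map on `C^*(L, L)` with prescribed components. -/
def CStar.lift₂ (b : ∀ k l : ℕ, cochains L k →ₗ[ℂ] cochains L l →ₗ[ℂ] CStar L) :
    CStar L →ₗ[ℂ] CStar L →ₗ[ℂ] CStar L :=
  DirectSum.toModule ℂ ℕ _ fun k => LinearMap.flip
    (DirectSum.toModule ℂ ℕ (cochains L k →ₗ[ℂ] CStar L) fun l => (b k l).flip)

@[simp] lemma CStar.lift₂_ofDeg (b : ∀ k l : ℕ, cochains L k →ₗ[ℂ] cochains L l →ₗ[ℂ] CStar L)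
    {k l : ℕ} (J : cochains L k) (K : cochains L l) :
    CStar.lift₂ b (ofDeg k J) (ofDeg l K) = b k l J K := by
  rw [lift₂, ofDeg, DirectSum.toModule_lof, LinearMap.flip_apply, ofDeg, DirectSum.toModule_lof,
    LinearMap.flip_apply]

/-- The insertion product `J ⊚ K` on `C^*(L, L)`. -/
def CStar.mul : CStar L →ₗ[ℂ] CStar L →ₗ[ℂ] CStar L :=
  CStar.lift₂ fun k l => (insLin rfl).compr₂ (ofDeg (k + l))

lemma CStar.mul_ofDeg {k l N : ℕ} (h : k + l = N) (J : cochains L k) (K : cochains L l) :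
    CStar.mul (ofDeg k J) (ofDeg l K) = ofDeg N (ins h J K) := by
  subst h
  rw [mul, lift₂_ofDeg]
  rfl

namespace LieConformalAlgebra

variable (A : LieConformalAlgebra L)

/-- The insertion product and the `λ`-bracket satisfy the axioms from which the graded Lie algebra
is constructed. The element `J` of `C^{k+1}` has degree `k` here. -/
lemma isPreLieWithSquareZero : IsPreLieWithSquareZero (fun k => LinearMap.range (ofDeg (L := L) k))
    CStar.mul (ofDeg 1 A.bracketCochain) where
  mul_mem := by
    rintro i j _ _ ⟨J, rfl⟩ ⟨K, rfl⟩
    exact ⟨ins rfl J K, (CStar.mul_ofDeg rfl J K).symm⟩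
  right_symm := by
    rintro i j k _ _ _ ⟨J, rfl⟩ ⟨K, rfl⟩ ⟨P, rfl⟩
    have := congrArg (ofDeg (i + j + k)) (ins_right_symm rfl rfl rfl (add_assoc i j k).symm rfl
      (add_right_comm i k j) (add_comm k j) J K P)
    simpa only [ofDeg_sub, map_smul, ← CStar.mul_ofDeg] using this
  mem_one := ⟨_, rfl⟩
  sq_zero := by
    rw [CStar.mul_ofDeg rfl, ins_bracketCochain, map_zero]
  quadratic := by
    rintro i j k _ _ _ ⟨J, rfl⟩ ⟨K, rfl⟩ ⟨P, rfl⟩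
    have := congrArg (ofDeg (1 + (i + j + k))) (ins_quadratic A.bracketCochain J K P
      (a := 1 + i) (b := 1 + (i + j)) (c := i + j) (d := j + k) (e := i + j + k) (f := i + k)
      (g := 1 + (i + k)) rfl (by omega) rfl rfl (by omega) rfl (by omega) (by omega) rfl rfl rfl
      (by omega) (by omega))
    simpa only [ofDeg_sub, map_add, map_smul, ← CStar.mul_ofDeg] using this

/-- The Frölicher–Nijenhuis bracket on `C^*(L, L)`. Its signs depend on the degrees, so it is
defined componentwise. -/
def fnStar : CStar L →ₗ[ℂ] CStar L →ₗ[ℂ] CStar L :=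
  CStar.lift₂ fun k l => LinearMap.compl₁₂
    (LinearMap.mk₂ ℂ (IsPreLieWithSquareZero.fn CStar.mul (ofDeg 1 A.bracketCochain) k l)
      (fun x x' y => by
        simp only [IsPreLieWithSquareZero.fn, IsPreLieWithSquareZero.diff, map_add,
          LinearMap.add_apply, map_sub, map_smul]
        module)
      (fun z x y => by
        simp only [IsPreLieWithSquareZero.fn, IsPreLieWithSquareZero.diff, LinearMap.smul_apply,
          map_sub, map_smul]
        module)
      (fun x y y' => by
        simp only [IsPreLieWithSquareZero.fn, IsPreLieWithSquareZero.diff, map_add,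
          LinearMap.add_apply, map_sub, map_smul]
        module)
      (fun z x y => by
        simp only [IsPreLieWithSquareZero.fn, IsPreLieWithSquareZero.diff, LinearMap.smul_apply,
          map_sub, map_smul]
        module))
    (ofDeg k) (ofDeg l)

lemma fnStar_apply {k l : ℕ} {x y : CStar L} (hx : x ∈ LinearMap.range (ofDeg (L := L) k))
    (hy : y ∈ LinearMap.range (ofDeg (L := L) l)) :
    A.fnStar x y = IsPreLieWithSquareZero.fn CStar.mul (ofDeg 1 A.bracketCochain) k l x y := by
  obtain ⟨J, rfl⟩ := hx
  obtain ⟨K, rfl⟩ := hy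
  rw [fnStar, CStar.lift₂_ofDeg]
  rfl

lemma fnStar_ofDeg {k l : ℕ} (J : cochains L k) (K : cochains L l) :
    A.fnStar (ofDeg k J) (ofDeg l K) = ofDeg (k + l + 1) (A.fnCochain J K) := by
  rw [A.fnStar_apply ⟨J, rfl⟩ ⟨K, rfl⟩]
  simp only [fnCochain, cupCochain, diffCochain, ofDeg_sub, map_add, map_smul, ← CStar.mul_ofDeg,
    IsPreLieWithSquareZero.fn, IsPreLieWithSquareZero.diff,
    IsPreLieWithSquareZero.cupProd, LinearMap.mk₂_apply]

lemma isGradedLieAlgebra : IsGradedLieAlgebra (degreePart L) A.fnStar where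
  grading := isInternal_range_lof rfl fun _ => rfl
  -- the part of degree `0` vanishes, so only parts of positive degree matter
  bracket_mem := by
    rintro (_ | k) (_ | l) x y hx hy
    all_goals try obtain rfl : x = 0 := hx
    all_goals try obtain rfl : y = 0 := hy
    all_goals try simp only [map_zero, LinearMap.zero_apply, zero_mem]
    rw [A.fnStar_apply hx hy]
    rw [show k + 1 + (l + 1) = k + l + 1 + 1 by omega]
    exact A.isPreLieWithSquareZero.fn_mem hx hy
  skew := by
    rintro (_ | k) (_ | l) x y hx hy
    all_goals try obtain rfl : x = 0 := hx
    all_goals try obtain rfl : y = 0 := hy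
    all_goals try simp only [map_zero, LinearMap.zero_apply, smul_zero]
    rw [A.fnStar_apply hx hy, A.fnStar_apply hy hx,
      ← A.isPreLieWithSquareZero.fn_symm hx hy]
  jacobi := by
    rintro (_ | k) (_ | l) (_ | r) x y z hx hy hz
    all_goals try obtain rfl : x = 0 := hx
    all_goals try obtain rfl : y = 0 := hy
    all_goals try obtain rfl : z = 0 := hz
    all_goals try simp only [map_zero, LinearMap.zero_apply, smul_zero, add_zero]
    have h := A.isPreLieWithSquareZero
    rw [A.fnStar_apply hy hz, A.fnStar_apply hx hy, A.fnStar_apply hx hz,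
      A.fnStar_apply hx (h.fn_mem hy hz), A.fnStar_apply (h.fn_mem hx hy) hz,
      A.fnStar_apply hy (h.fn_mem hx hz)]
    exact h.fn_jacobi hx hy hz

end LieConformalAlgebra

end

/-! ### Cochains of degree one and Nijenhuis operators -/

section

variable {L : Type u} [AddCommGroup L] [Module ℂ L] [Module (Polynomial ℂ) L]
  [IsScalarTower ℂ (Polynomial ℂ) L]

/-- `C¹(L, L)` consists of the `ℂ[∂]`-linear maps. -/
lemma oneCochain_bijective : Function.Bijective (oneCochain (L := L)) := by
  constructor
  · intro N N' h
    ext p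
    have := congrArg (fun f : cochains L 0 => f.1 fun _ => p) h
    exact Finsupp.single_injective _ this
  · intro f
    have hconst : ∀ p, f.1 p = const 0 (f.1 p 0) := fun p => Finsupp.unique_single _
    have hp : ∀ p : Fin 1 → L, Function.update p 0 (p 0) = p := fun p => Function.update_eq_self _ _
    -- the constant coefficient, the only one of a polynomial in no variables
    let T : L →ₗ[ℂ] L := (Finsupp.lapply 0).comp (f.1.toLinearMap 0 0)
    have hT : ∀ p : Fin 1 → L, T (p 0) = f.1 p 0 := fun p => by
      change f.1 (Function.update 0 0 (p 0)) 0 = _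
      congr 2
      funext i
      obtain rfl : i = 0 := Fin.fin_one_eq_zero i
      simp
    -- sesquilinearity in the only, hence last, argument is commutation with `∂`
    have hD : ∀ a, T ((Polynomial.X : Polynomial ℂ) • a)
        = (Polynomial.X : Polynomial ℂ) • T a := fun a => by
      have h := congrArg (fun P : LPoly L 0 => P 0) (f.2.1 (fun _ => a) (Fin.last 0))
      simp only [specOp, Fin.lastCases_last] at h
      have h1 := hT (Function.update (fun _ => a) 0 (partialOp L a))
      have h2 := hT fun _ => a
      rw [Function.update_self] at h1
      have h3 : T (partialOp L a) = partialOp L (T a) := by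
        rw [h1, h2]
        refine h.trans ?_
        simp [lamDagger, onCoeff]
      exact h3
    have hpoly : ∀ (q : Polynomial ℂ) (a : L), T (q • a) = q • T a := fun q => by
      induction q using Polynomial.induction_on' with
      | add q r hq hr => intro a; rw [add_smul, map_add, hq, hr, add_smul]
      | monomial n z =>
        rw [← Polynomial.C_mul_X_pow_eq_monomial, ← Polynomial.smul_eq_C_mul]
        induction n with
        | zero => intro a; simp
        | succ n ih =>
          intro a
          rw [pow_succ, ← smul_mul_assoc, mul_smul, ih, hD, mul_smul]
    refine ⟨{ T with map_smul' := hpoly }, Subtype.ext (MultilinearMap.ext fun p => ?_)⟩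
    rw [hconst p, ← hT p]
    rfl

section

variable {R M : Type*} [CommRing R] [Algebra ℂ R]
  [AddCommGroup M] [Module ℂ M] [Module R M] [IsScalarTower ℂ R M]

lemma pair_oneCochain (N : L →ₗ[Polynomial ℂ] L) (x : R × L) {φ : L → M}
    (hφ : φ ∈ weightSpace L M x.1) :
    pair (functional (oneCochain N).1 [x]) φ = φ (N x.2) :=
  (pair_functional_ofFn _ (fun _ : Fin 1 => x) φ).trans (evalAt_const hφ _)

lemma comp_mem_weightSpace (N : L →ₗ[Polynomial ℂ] L) {w : R} {φ : L → M}
    (hφ : φ ∈ weightSpace L M w) : (fun a => φ (N a)) ∈ weightSpace L M w := by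
  refine ⟨fun a b => ?_, fun z a => ?_, fun a => ?_⟩
  · simp only [map_add, weightSpace_add hφ]
  · simp only [N.map_smul_of_tower, hφ.2.1]
  · exact (congrArg φ (N.map_smul Polynomial.X a)).trans (hφ.2.2 (N a))

end

namespace LieConformalAlgebra

variable (A : LieConformalAlgebra L)

/-- The Nijenhuis torsion `[Np_λ Nq] - N([Np_λ q] + [p_λ Nq] - N[p_λ q])`. -/
def torsion (N : L →ₗ[Polynomial ℂ] L) : PreCochain L 1 := fun p =>
  A.bracket (N (p 0)) (N (p 1)) - onCoeff (N.restrictScalars ℂ) (A.bracket (N (p 0)) (p 1)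
    + A.bracket (p 0) (N (p 1)) - onCoeff (N.restrictScalars ℂ) (A.bracket (p 0) (p 1)))

lemma isNijenhuis_iff_torsion (N : L →ₗ[Polynomial ℂ] L) : A.IsNijenhuis N ↔ A.torsion N = 0 := by
  constructor
  · intro h
    funext p
    exact sub_eq_zero.2 (h (p 0) (p 1))
  · intro h p q
    simpa [torsion, sub_eq_zero] using congrFun h ![p, q]

/-- `[N, N]` is twice the Nijenhuis torsion: the cup product contributes `2 [Np, Nq]`, and each of
the two insertions of the coboundary contributes `-N([Np, q] + [p, Nq] - N[p, q])`. -/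
lemma coe_fnCochain_oneCochain (N : L →ₗ[Polynomial ℂ] L) :
    (⇑(A.fnCochain (oneCochain N) (oneCochain N)).1 : PreCochain L 1) = (2 : ℂ) • A.torsion N := by
  refine PreCochain.ext_functional fun R _ _ _ _ xs φ hφ => ?_
  by_cases hn : xs.length = 2
  swap
  · rw [functional_hasArity _ _ hn, functional_hasArity _ _ hn]
  obtain ⟨x, y, rfl⟩ := List.length_eq_two.1 hn
  -- functionals vanish on lists of the wrong length, which leaves few terms in each sum
  have hN0 : functional (R := R) (oneCochain N).1 [] = 0 := functional_hasArity _ _ (by simp)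
  have hN2 : ∀ a b, functional (R := R) (oneCochain N).1 [a, b] = 0 := fun a b =>
    functional_hasArity _ _ (by simp)
  have hB1 : ∀ a, functional (R := R) A.bracketCochain.1 [a] = 0 := fun a =>
    functional_hasArity _ _ (by simp)
  have hB0 : functional (R := R) A.bracketCochain.1 [] = 0 :=
    functional_hasArity _ _ (by simp)
  have hB3 : ∀ a b c, functional (R := R) A.bracketCochain.1 [a, b, c] = 0 := fun a b c =>
    functional_hasArity _ _ (by simp)
  have hD0 : functional (R := R) (A.diffCochain (oneCochain N)).1 [] = 0 :=
    functional_hasArity _ _ (by simp)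
  have hD1 : ∀ a, functional (R := R) (A.diffCochain (oneCochain N)).1 [a] = 0 := fun a =>
    functional_hasArity _ _ (by simp)
  have cB := functional_isConformal (R := R) (M := LPoly L 1) A.bracketCochain
  rw [coe_bracketCochain] at cB hB0 hB1 hB3
  have hψ := comp_mem_weightSpace N hφ
  have hs : ∀ (ψ : L → LPoly L 1) (t u : R × L), ψ ∈ weightSpace L _ (t.1 + u.1) →
      (fun c => pair (functional A.bracketMap [(t.1, c), u]) ψ) ∈ weightSpace L _ t.1 ∧
      (fun c => pair (functional A.bracketMap [t, (u.1, c)]) ψ) ∈ weightSpace L _ u.1 :=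
    fun ψ t u h => ⟨cB.slot [] [u] _ ψ (by simpa using h), cB.slot [t] [] _ ψ (by simpa using h)⟩
  have hskew : ∀ (ψ : L → LPoly L 1) (t u : R × L), ψ ∈ weightSpace L _ (t.1 + u.1) →
      pair (functional A.bracketMap [t, u]) ψ = - pair (functional A.bracketMap [u, t]) ψ :=
    fun ψ t u h => cB.skew [] [] t u ψ (by simpa using h)
  have hxy : φ ∈ weightSpace L _ (x.1 + y.1) := by simpa using hφ
  have hyx : φ ∈ weightSpace L _ (y.1 + x.1) := add_comm x.1 y.1 ▸ hxy
  have kxy := comp_mem_weightSpace N hxy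
  have kyx := comp_mem_weightSpace N hyx
  have hD : pair (functional (A.diffCochain (oneCochain N)).1 [x, y]) (fun c => φ (N c))
      = pair (functional A.bracketMap [(x.1, N x.2), y]) (fun c => φ (N c))
        + pair (functional A.bracketMap [x, (y.1, N y.2)]) (fun c => φ (N c))
        - pair (functional A.bracketMap [x, y]) (fun c => φ (N (N c))) := by
    rw [← value_apply _ _ hψ, diffCochain, value_sub, map_smul, value_ins, value_ins,
      coe_bracketCochain]
    simp only [unsh_cons, unsh_nil, hN0, hN2, hB0, hB1, hB3, map_zero, LinearMap.zero_apply,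
      wt_cons, wt_nil]
    simp only [add_zero, zero_add, pow_zero, one_smul, List.length_cons, List.length_nil, pow_one,
      neg_smul, smul_zero]
    rw [pair_oneCochain N x (hs _ x y kxy).1, pair_oneCochain N y (hs _ y x kyx).1,
      hskew _ (y.1, N y.2) x kyx]
    simp only [pair_oneCochain N (x.1 + y.1, _) kxy]
    simp
  have hC : value [x, y] φ hφ (A.cupCochain (oneCochain N) (oneCochain N))
      = (2 : ℂ) • pair (functional A.bracketMap [(x.1, N x.2), (y.1, N y.2)]) φ := by
    rw [value_apply, coe_cupCochain, functional_cup A _ _ _ _ hφ]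
    simp only [unsh_cons, unsh_nil, hN0, hN2, map_zero, LinearMap.zero_apply, wt_cons, wt_nil]
    simp only [add_zero, zero_add, pow_zero, one_smul, List.length_cons, List.length_nil, pow_one,
      neg_smul, smul_zero]
    have h₁ : ∀ b, (pair (functional (oneCochain N).1 [y]) fun c =>
        pair (functional A.bracketMap [(x.1, b), (y.1, c)]) φ)
          = pair (functional A.bracketMap [(x.1, b), (y.1, N y.2)]) φ := fun b =>
      pair_oneCochain N y (hs φ (x.1, b) y hxy).2
    have h₂ : ∀ b, (pair (functional (oneCochain N).1 [x]) fun c =>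
        pair (functional A.bracketMap [(y.1, b), (x.1, c)]) φ)
          = pair (functional A.bracketMap [(y.1, b), (x.1, N x.2)]) φ := fun b =>
      pair_oneCochain N x (hs φ (y.1, b) x hyx).2
    simp only [h₁, h₂]
    rw [pair_oneCochain N x (hs φ x (y.1, N y.2) hxy).1,
      pair_oneCochain N y (hs φ y (x.1, N x.2) hyx).1,
      hskew _ (y.1, N y.2) (x.1, N x.2) hyx, two_smul, neg_neg]
  rw [← value_apply _ _ hφ, fnCochain, value_sub, map_add, map_smul, map_smul, value_ins, hC]
  -- the insertions of the coboundary in `N` reduce to its value under `φ ∘ N`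
  simp only [unsh_cons, unsh_nil, hN2, hD0, hD1, map_zero, LinearMap.zero_apply, wt_cons, wt_nil]
  simp only [add_zero, zero_add, pow_zero, one_smul, List.length_cons, List.length_nil, pow_one,
    neg_smul, smul_zero]
  simp only [pair_oneCochain N (x.1 + y.1, _) hxy]
  rw [hD, pair_functional_two ((2 : ℂ) • A.torsion N)]
  change _ = evalHom _ hxy ((2 : ℂ) • A.torsion N ![x.2, y.2])
  have e := fun P => evalAt_onCoeff (t := ![x.1, y.1]) hxy (N.restrictScalars ℂ) P
  have e' := fun P => evalAt_onCoeff (t := ![x.1, y.1]) kxy (N.restrictScalars ℂ) P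
  rw [map_smul, torsion, map_sub, evalHom_apply, evalHom_apply, e]
  simp only [LinearMap.coe_restrictScalars] at e' ⊢
  rw [← evalHom_apply _ kxy, map_sub, map_add]
  simp only [evalHom_apply, e', pair_bracketMap]
  simp
  module

lemma isNijenhuis_iff_isMaurerCartan (N : L →ₗ[Polynomial ℂ] L) :
    A.IsNijenhuis N ↔ IsMaurerCartan (degreePart L) A.fnStar (ofDeg 0 (oneCochain N)) := by
  rw [isNijenhuis_iff_torsion, IsMaurerCartan, fnStar_ofDeg]
  have h2 : A.fnCochain (oneCochain N) (oneCochain N) = 0 ↔ A.torsion N = 0 := by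
    have h := A.coe_fnCochain_oneCochain N
    constructor
    · intro h0
      rw [h0] at h
      exact (smul_eq_zero.1 h.symm).resolve_left two_ne_zero
    · intro h0
      rw [h0, smul_zero] at h
      exact Subtype.ext (DFunLike.coe_injective h)
  rw [← h2]
  constructor
  · intro h
    exact ⟨⟨_, rfl⟩, by rw [h, map_zero]⟩
  · rintro ⟨-, h⟩
    exact DirectSum.of_injective (β := fun k => cochains L k) _ (h.trans (map_zero (ofDeg 1)).symm)

end LieConformalAlgebra

end

end LieConf

end

theorem theorem3p1 {L : Type*} [AddCommGroup L] [Module ℂ L] [Module (Polynomial ℂ) L]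
    [IsScalarTower ℂ (Polynomial ℂ) L] (A : LieConf.LieConformalAlgebra L) :
    ∃ br : LieConf.CStar L →ₗ[ℂ] LieConf.CStar L →ₗ[ℂ] LieConf.CStar L,
      (∀ (k l : ℕ) (J : LieConf.cochains L k) (K : LieConf.cochains L l),
        ∃ F : LieConf.cochains L (k + l + 1),
          (⇑F.1 : LieConf.PreCochain L (k + l + 1)) = A.fnBracket (⇑J.1) (⇑K.1) ∧
          br (LieConf.ofDeg k J) (LieConf.ofDeg l K) = LieConf.ofDeg (k + l + 1) F) ∧
      LieConf.IsGradedLieAlgebra (LieConf.degreePart L) br ∧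
      Function.Bijective (LieConf.oneCochain (L := L)) ∧
      ∀ N : L →ₗ[Polynomial ℂ] L,
        A.IsNijenhuis N ↔
          LieConf.IsMaurerCartan (LieConf.degreePart L) br
            (LieConf.ofDeg 0 (LieConf.oneCochain N)) :=
  ⟨A.fnStar, fun _ _ J K => ⟨A.fnCochain J K, A.coe_fnCochain J K, A.fnStar_ofDeg J K⟩,
    A.isGradedLieAlgebra, LieConf.oneCochain_bijective, A.isNijenhuis_iff_isMaurerCartan⟩
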